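/- Let $\Gamma$ be a group. A $\Gamma$-group is a group on which $\Gamma$ acts by automorphisms. For a $\Gamma$-group $G$ let $H_n^\Gamma(G)=\operatorname{Tor}^{\mathcal P}_n(\mathbb Z,\mathbb Z)$ be the equivariant integral homology: $\operatorname{Tor}$ is formed in the category of $G\rtimes\Gamma$-modules relative to the class $\mathcal P$ of retracts of those $G\rtimes\Gamma$-modules which are free as $G$-modules on a basis stable under $\Gamma$ (with respect to exact sequences split by maps of $\Gamma$-sets). Equivalently, $H_n^\Gamma(G)=H_n(B_*\otimes_{G\rtimes\Gamma}\mathbb Z)$, where $B_*$ is the bar resolution of $\mathbb Z$ over $\mathbb Z[G]$ with the action ${}^\sigma(g[g_1,\dots,g_n])={}^\sigma g[{}^\sigma g_1,\dots,{}^\sigma g_n]$ of $\Gamma$. For a normal $\Gamma$-subgroup $H$ of $G$ let $[G,H]_\Gamma$ be the subgroup generated by the elements $x\,{}^\sigma y\,x^{-1}y^{-1}$ with $x\in G$, $y\in H$, $\sigma\in\Gamma$. A projective presentation of a $\Gamma$-group $E$ is a $\Gamma$-homomorphism $\tau:P\to E$ which has a section that is a map of $\Gamma$-sets, where $P$ is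 a $\Gamma$-group that is a retract (by $\Gamma$-homomorphisms) of a free group having a basis stable under $\Gamma$. Theorem. Let $1\to N\to E\xrightarrow{\alpha}G\to1$ be a short exact sequence of $\Gamma$-groups such that $\alpha$ has a section that is a map of $\Gamma$-sets, and let $\tau:P\to E$ be a projective presentation of the $\Gamma$-group $E$. Put $R=\operatorname{Ker}\tau$ and $S=\operatorname{Ker}(\alpha\tau)$. Then there is an exact sequence $$0\to U\to H_2^\Gamma(E)\to H_2^\Gamma(G)\xrightarrow{\ \delta\ }N/[E,N]_\Gamma\to H_1^\Gamma(E)\to H_1^\Gamma(G)\to0,$$ where $U$ is the kernel of the homomorphism $[P,S]_\Gamma/[P,R]_\Gamma\to[E,N]_\Gamma$ induced by $\tau$. The maps $H_n^\Gamma(E)\to H_n^\Gamma(G)$, $n=1,2$, are induced by $\alpha$, and $N/[E,N]_\Gamma\to H_1^\Gamma(E)$ is induced by the inclusion $N\to E$ and the natural map $E\to H_1^\Gamma(E)$, $e\mapsto$ class of $[e]$. -/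

import Mathlib

universe u v w

noncomputable section

namespace EquivHomology

/-! ### Modules over the semidirect product and relatively projective modules

A `Γ`-group is a group `G` with `[MulDistribMulAction Γ G]`; morphisms of `Γ`-groups are Mathlib's
`G →*[Γ] H`. A `Γ`-equivariant `G`-module is a module over `G ⋊ Γ`, that is, a
`Representation ℤ (G ⋊ Γ) M`. -/

section Modules

variable (Γ : Type w) [Group Γ] (G : Type u) [Group G] [MulDistribMulAction Γ G]

/-- The semidirect product `G ⋊ Γ` of a `Γ`-group `G` with `Γ`. -/
abbrev SProd : Type (max u w) := G ⋊[MulDistribMulAction.toMulAut Γ G] Γ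

variable {Γ G}

/-- `M` is relatively free: it is free as a `G`-module, with a basis `b : S → M` that is permuted
by `Γ`. Being a `ℤ[G]`-basis is expressed by saying that the elements `g • b s`, for `(g, s)` in
`G × S`, form a `ℤ`-basis. -/
def IsRelFree {M : Type u} [AddCommGroup M] (ρ : Representation ℤ (SProd Γ G) M) : Prop :=
  ∃ (S : Type u) (_ : MulAction Γ S) (b : S → M) (B : Module.Basis (G × S) ℤ M),
    (∀ (σ : Γ) (s : S), ρ (SemidirectProduct.inr σ) (b s) = b (σ • s)) ∧
    ∀ (g : G) (s : S), B (g, s) = ρ (SemidirectProduct.inl g) (b s)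

/-- `M` is relatively projective: it is a retract of a relatively free `G ⋊ Γ`-module. -/
def IsRelProjective {M : Type u} [AddCommGroup M] (ρ : Representation ℤ (SProd Γ G) M) : Prop :=
  ∃ (F : Type u) (_ : AddCommGroup F) (ρF : Representation ℤ (SProd Γ G) F),
    IsRelFree ρF ∧
    ∃ (i : Representation.IntertwiningMap ρ ρF) (r : Representation.IntertwiningMap ρF ρ),
      ∀ x, r (i x) = x

/-- The epimorphism of `M` onto the image of `f` is `Γ`-splitting: over the image of `f` there is
a section of `f` which is a map of `Γ`-sets (not necessarily additive). -/
def GammaSplits {M M' : Type u} [AddCommGroup M] [AddCommGroup M']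
    {ρ : Representation ℤ (SProd Γ G) M} {ρ' : Representation ℤ (SProd Γ G) M'}
    (f : Representation.IntertwiningMap ρ ρ') : Prop :=
  ∃ γ : M' → M, ∀ y ∈ Set.range f, f (γ y) = y ∧
    ∀ σ : Γ, γ (ρ' (SemidirectProduct.inr σ) y) = ρ (SemidirectProduct.inr σ) (γ y)

variable (Γ G)

/-- A relatively projective resolution `⋯ → X₁ → X₀ → ℤ → 0` of the trivial `G ⋊ Γ`-module `ℤ`:
an exact sequence of `G ⋊ Γ`-modules, with all `Xₙ` relatively projective, such that each
`0 → Ker → Xₙ → Im → 0` is proper, that is, `Γ`-splitting. -/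
structure RelResolution where
  /-- the modules of the resolution -/
  X : ℕ → Type u
  [grp : ∀ n, AddCommGroup (X n)]
  /-- the actions of `G ⋊ Γ` -/
  ρ : ∀ n, Representation ℤ (SProd Γ G) (X n)
  /-- the differential `X (n + 1) → X n` -/
  d : ∀ n, Representation.IntertwiningMap (ρ (n + 1)) (ρ n)
  /-- the augmentation -/
  ε : X 0 →ₗ[ℤ] ℤ
  ε_inv : ∀ a x, ε (ρ 0 a x) = ε x
  projective : ∀ n, IsRelProjective (ρ n)
  exact : ∀ n, Function.Exact (d (n + 1)) (d n)
  exact_zero : Function.Exact (d 0) ε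
  splits : ∀ n, GammaSplits (d n)
  ε_splits : ∃ γ : ℤ → X 0, ∀ m, ε (γ m) = m ∧
    ∀ σ : Γ, ρ 0 (SemidirectProduct.inr σ) (γ m) = γ m

attribute [instance] RelResolution.grp

namespace RelResolution

variable {Γ G}
variable (Q : RelResolution Γ G)

/-- The chains `ℤ ⊗_{G ⋊ Γ} Xₙ`, realized as the coinvariants of `Xₙ`. -/
abbrev Chains (n : ℕ) : Type u := (Q.ρ n).Coinvariants

/-- The differential of the complex of coinvariants. -/
def dC (n : ℕ) : Q.Chains (n + 1) →ₗ[ℤ] Q.Chains n :=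
  Representation.Coinvariants.map _ _ (Q.d n)

/-- The cycles of the complex of coinvariants. -/
def cycles : ∀ n : ℕ, Submodule ℤ (Q.Chains n)
  | 0 => ⊤
  | n + 1 => LinearMap.ker (Q.dC n)

/-- The boundaries of the complex of coinvariants. -/
def boundaries (n : ℕ) : Submodule ℤ (Q.Chains n) := LinearMap.range (Q.dC n)

/-- The homology of the complex of coinvariants `ℤ ⊗_{G ⋊ Γ} X_*`: the relative `Tor`-group
of `ℤ` and `ℤ` computed by the resolution. -/
abbrev Homology (n : ℕ) : Type u := Q.cycles n ⧸ (Q.boundaries n).submoduleOf (Q.cycles n)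

end RelResolution

end Modules

/-! ### The equivariant bar resolution -/

section Bar

variable (Γ : Type w) [Group Γ] (G : Type u) [Group G] [MulDistribMulAction Γ G]

/-- The free abelian group with basis the elements `g[g₁, …, gₙ]`, encoded as
`(g, ![g₁, …, gₙ])`; it is the free `ℤ[G]`-module on the symbols `[g₁, …, gₙ]`. -/
abbrev Bar (n : ℕ) : Type u := (G × (Fin n → G)) →₀ ℤ

/-- The action of `(h, σ)` on basis elements:
`g[g₁, …, gₙ] ↦ (h · σg)[σg₁, …, σgₙ]`. -/
def barAct (n : ℕ) (a : SProd Γ G) (p : G × (Fin n → G)) : G × (Fin n → G) :=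
  (a.left * a.right • p.1, fun i => a.right • p.2 i)

/-- The action of `G ⋊ Γ` on the bar resolution. -/
def barRho (n : ℕ) : Representation ℤ (SProd Γ G) (Bar G n) where
  toFun a := Finsupp.lmapDomain ℤ ℤ (barAct Γ G n a)
  map_one' := by
    ext p : 2
    simp [barAct]
  map_mul' a b := by
    ext p : 2
    simp [barAct, mul_smul, mul_assoc]

variable {G} in
/-- The boundary of a basis element `g[g₁, …, gₙ₊₁]`:
`g g₁[g₂, …, gₙ₊₁] + ∑ⱼ (-1)ʲ g[g₁, …, gⱼ gⱼ₊₁, …, gₙ₊₁] + (-1)ⁿ⁺¹ g[g₁, …, gₙ]`. -/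
def barBd (n : ℕ) (p : G × (Fin (n + 1) → G)) : Bar G n :=
  Finsupp.single (p.1 * p.2 0, Fin.tail p.2) 1 +
    ∑ j : Fin (n + 1),
      Finsupp.single (p.1, Fin.contractNth j (· * ·) p.2) ((-1 : ℤ) ^ ((j : ℕ) + 1))

/-- The differential of the bar resolution, as a map of abelian groups. -/
def barDLin (n : ℕ) : Bar G (n + 1) →ₗ[ℤ] Bar G n :=
  Finsupp.linearCombination ℤ (barBd n)

lemma barDLin_single (n : ℕ) (p : G × (Fin (n + 1) → G)) :
    barDLin G n (Finsupp.single p 1) = barBd n p := by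
  simp [barDLin]

lemma barRho_single (n : ℕ) (a : SProd Γ G) (p : G × (Fin n → G)) (m : ℤ) :
    barRho Γ G n a (Finsupp.single p m) = Finsupp.single (barAct Γ G n a p) m := by
  simp [barRho]

/-- The differential of the bar resolution. -/
def barD (n : ℕ) : Representation.IntertwiningMap (barRho Γ G (n + 1)) (barRho Γ G n) where
  toLinearMap := barDLin G n
  isIntertwining' a := by
    ext p : 2
    have h : ∀ j : Fin (n + 1),
        (fun i => a.right • Fin.contractNth j (· * ·) p.2 i)
          = Fin.contractNth j (· * ·) (fun i => a.right • p.2 i) := fun j =>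
      Fin.comp_contractNth (f := fun x : G => a.right • x) (· * ·) (· * ·)
        (fun x y => smul_mul' a.right x y) j p.2
    simp [barDLin_single, barRho_single, barBd, barAct, mul_assoc, h]
    rfl

/-- The augmentation `ε : ℤ[G] → ℤ`. -/
def barEps : Bar G 0 →ₗ[ℤ] ℤ := Finsupp.linearCombination ℤ (fun _ => (1 : ℤ))

/-- The contraction `g[g₁, …, gₙ] ↦ [g, g₁, …, gₙ]` of the bar resolution. -/
def barS (n : ℕ) : Bar G n →ₗ[ℤ] Bar G (n + 1) :=
  Finsupp.lmapDomain ℤ ℤ (fun p => (1, Fin.cons p.1 p.2))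

lemma barS_single (n : ℕ) (p : G × (Fin n → G)) (m : ℤ) :
    barS G n (Finsupp.single p m) = Finsupp.single (1, Fin.cons p.1 p.2) m := by
  simp [barS]

lemma contractNth_zero_cons (n : ℕ) (g : G) (v : Fin (n + 1) → G) :
    Fin.contractNth 0 (· * ·) (Fin.cons g v : Fin (n + 2) → G)
      = Fin.cons (g * v 0) (Fin.tail v) := by
  funext k
  refine Fin.cases ?_ (fun k => ?_) k <;> simp [Fin.contractNth, Fin.tail]

lemma contractNth_succ_cons (n : ℕ) (j : Fin (n + 1)) (g : G) (v : Fin (n + 1) → G) :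
    Fin.contractNth j.succ (· * ·) (Fin.cons g v : Fin (n + 2) → G)
      = Fin.cons g (Fin.contractNth j (· * ·) v) := by
  funext k
  refine Fin.cases ?_ (fun k => ?_) k
  · simp [Fin.contractNth]
  · simp [Fin.contractNth]

lemma barS_equivariant (n : ℕ) (σ : Γ) (x : Bar G n) :
    barS G n (barRho Γ G n (SemidirectProduct.inr σ) x)
      = barRho Γ G (n + 1) (SemidirectProduct.inr σ) (barS G n x) := by
  induction x using Finsupp.induction_linear with
  | zero => simp
  | add x y hx hy => simp [hx, hy]
  | single p m =>
    simp only [barS_single, barRho_single]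
    congr 1
    simp only [barAct, SemidirectProduct.left_inr, SemidirectProduct.right_inr, one_mul,
      smul_one, Prod.mk.injEq, true_and]
    funext k
    refine Fin.cases ?_ (fun k => ?_) k <;> simp

lemma barDLin_barS_zero (x : Bar G 0) :
    barDLin G 0 (barS G 0 x) = x - Finsupp.single (1, Fin.elim0) (barEps G x) := by
  induction x using Finsupp.induction_linear with
  | zero => simp
  | add x y hx hy => simp only [map_add, hx, hy, Finsupp.single_add]; abel
  | single p m =>
    obtain ⟨g, v⟩ := p
    have h1 : (Finsupp.single (g, v) m : Bar G 0) = m • Finsupp.single (g, v) 1 := by simp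
    have hv : v = Fin.elim0 := Subsingleton.elim _ _
    subst hv
    rw [h1, map_smul, map_smul, map_smul, barS_single, barDLin_single]
    simp [barBd, barEps, smul_add, sub_eq_add_neg]
    congr 2
    exact Subsingleton.elim _ _

lemma barDLin_barS_succ (n : ℕ) (x : Bar G (n + 1)) :
    barDLin G (n + 1) (barS G (n + 1) x) = x - barS G n (barDLin G n x) := by
  induction x using Finsupp.induction_linear with
  | zero => simp
  | add x y hx hy => simp only [map_add, hx, hy]; abel
  | single p m =>
    obtain ⟨g, v⟩ := p
    have h1 : (Finsupp.single (g, v) m : Bar G (n + 1)) = m • Finsupp.single (g, v) 1 := by simp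
    rw [h1]
    simp only [map_smul]
    rw [← smul_sub]
    congr 1
    rw [barS_single, barDLin_single, barDLin_single, barBd, barBd, Fin.sum_univ_succ]
    simp only [map_add, map_sum, barS_single, contractNth_zero_cons, contractNth_succ_cons,
      Fin.cons_zero, Fin.tail_cons, one_mul, Fin.val_zero, Fin.val_succ]
    rw [sub_eq_add_neg, neg_add]
    refine congrArg₂ (· + ·) rfl (congrArg₂ (· + ·) ?_ ?_)
    · rw [← Finsupp.single_neg]
      simp
    · rw [← Finset.sum_neg_distrib]
      refine Finset.sum_congr rfl fun x _ => ?_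
      rw [pow_succ, mul_neg_one, Finsupp.single_neg]

lemma barEps_barD (x : Bar G 1) : barEps G (barDLin G 0 x) = 0 := by
  induction x using Finsupp.induction_linear with
  | zero => simp
  | add x y hx hy => simp [hx, hy]
  | single p m =>
    have h1 : (Finsupp.single p m : Bar G 1) = m • Finsupp.single p 1 := by simp
    rw [h1, map_smul, map_smul, barDLin_single]
    simp [barBd, barEps]

lemma barD_barD (n : ℕ) (x : Bar G (n + 2)) : barDLin G n (barDLin G (n + 1) x) = 0 := by
  have key : ∀ n : ℕ, (∀ y : Bar G (n + 1),
      barDLin G n (barDLin G (n + 1) (barS G (n + 1) y)) = 0) →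
      ∀ x : Bar G (n + 2), barDLin G n (barDLin G (n + 1) x) = 0 := by
    intro n hn x
    induction x using Finsupp.induction_linear with
    | zero => simp
    | add x y hx hy => simp [hx, hy]
    | single p m =>
      obtain ⟨g, v⟩ := p
      have h1 : (Finsupp.single (g, v) m : Bar G (n + 2))
          = barRho (MulAut G) G (n + 2) (SemidirectProduct.inl g)
            (barS G (n + 1) (Finsupp.single (v 0, Fin.tail v) m)) := by
        rw [barS_single, barRho_single]
        simp [barAct]
      have e1 := fun z => Representation.IntertwiningMap.isIntertwining _ _ (barD (MulAut G) G (n + 1)) (SemidirectProduct.inl g) z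
      have e2 := fun z => Representation.IntertwiningMap.isIntertwining _ _ (barD (MulAut G) G n) (SemidirectProduct.inl g) z
      rw [h1]
      refine (congrArg (barDLin G n) (e1 _)).trans ((e2 _).trans ?_)
      refine (congrArg (barRho (MulAut G) G n (SemidirectProduct.inl g)) (hn _)).trans (map_zero _)
  induction n with
  | zero =>
    refine key 0 (fun y => ?_) x
    rw [barDLin_barS_succ, map_sub, barDLin_barS_zero, barEps_barD]
    simp
  | succ n ih =>
    refine key (n + 1) (fun y => ?_) x
    rw [barDLin_barS_succ, map_sub, barDLin_barS_succ, ih]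
    simp

lemma barEps_barRho (a : SProd Γ G) (x : Bar G 0) :
    barEps G (barRho Γ G 0 a x) = barEps G x := by
  induction x using Finsupp.induction_linear with
  | zero => simp
  | add x y hx hy => simp [hx, hy]
  | single p m => simp [barRho_single, barEps]

lemma bar_isRelFree (n : ℕ) : IsRelFree (barRho Γ G n) := by
  refine ⟨Fin n → G, inferInstance, fun v => Finsupp.single (1, v) 1,
    Finsupp.basisSingleOne, fun σ v => ?_, fun g v => ?_⟩
  · rw [barRho_single]
    simp [barAct]
    rfl
  · rw [barRho_single]
    simp [barAct]

/-- The equivariant bar resolution of the trivial `G ⋊ Γ`-module `ℤ`; it is a relatively free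
resolution. -/
def barResolution : RelResolution Γ G where
  X := Bar G
  ρ := barRho Γ G
  d := barD Γ G
  ε := barEps G
  ε_inv := barEps_barRho Γ G
  projective n := ⟨Bar G n, inferInstance, barRho Γ G n, bar_isRelFree Γ G n,
    Representation.IntertwiningMap.id _, Representation.IntertwiningMap.id _, fun _ => rfl⟩
  exact n := by
    intro y
    constructor
    · intro hy
      refine ⟨barS G (n + 1) y, ?_⟩
      have h := barDLin_barS_succ G n y
      have hy' : barDLin G n y = 0 := hy
      rw [hy', map_zero, sub_zero] at h
      exact h
    · rintro ⟨x, rfl⟩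
      exact barD_barD G n x
  exact_zero := by
    intro y
    constructor
    · intro hy
      refine ⟨barS G 0 y, ?_⟩
      have h := barDLin_barS_zero G y
      rw [hy, Finsupp.single_zero, sub_zero] at h
      exact h
    · rintro ⟨x, rfl⟩
      exact barEps_barD G x
  splits n := by
    refine ⟨barS G n, ?_⟩
    rintro _ ⟨x, rfl⟩
    refine ⟨?_, fun σ => barS_equivariant Γ G n σ _⟩
    cases n with
    | zero =>
      have h := barDLin_barS_zero G (barDLin G 0 x)
      rw [barEps_barD, Finsupp.single_zero, sub_zero] at h
      exact h
    | succ n =>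
      have h := barDLin_barS_succ G n (barDLin G (n + 1) x)
      rw [barD_barD, map_zero, sub_zero] at h
      exact h
  ε_splits := by
    refine ⟨fun m => Finsupp.single (1, Fin.elim0) m, fun m => ⟨by simp [barEps], fun σ => ?_⟩⟩
    rw [barRho_single]
    congr 1
    simp only [barAct, SemidirectProduct.left_inr, SemidirectProduct.right_inr, one_mul,
      smul_one, Prod.mk.injEq, true_and]
    exact Subsingleton.elim _ _

end Bar

/-! ### Equivariant integral homology -/

section Homology

/-- The equivariant integral homology `H_n^Γ(G) = Tor_n(ℤ, ℤ)` of a `Γ`-group `G`, where `Tor` is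
taken relative to the relatively projective `G ⋊ Γ`-modules and computed by the equivariant bar
resolution. -/
abbrev H (Γ : Type w) [Group Γ] (G : Type u) [Group G] [MulDistribMulAction Γ G] (n : ℕ) :
    Type u :=
  (barResolution Γ G).Homology n

variable {Γ : Type w} [Group Γ] {E : Type u} [Group E] [MulDistribMulAction Γ E]
  {G : Type v} [Group G] [MulDistribMulAction Γ G]

/-- The map `g[g₁, …, gₙ] ↦ f(g)[f(g₁), …, f(gₙ)]` of bar resolutions induced by `f`. -/
def barMap (f : E →*[Γ] G) (n : ℕ) : Bar E n →ₗ[ℤ] Bar G n :=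
  Finsupp.lmapDomain ℤ ℤ (fun p => (f p.1, fun i => f (p.2 i)))

lemma barMap_single (f : E →*[Γ] G) (n : ℕ) (p : E × (Fin n → E)) (m : ℤ) :
    barMap f n (Finsupp.single p m) = Finsupp.single (f p.1, fun i => f (p.2 i)) m := by
  simp [barMap]

lemma barMap_barD (f : E →*[Γ] G) (n : ℕ) (x : Bar E (n + 1)) :
    barMap f n (barDLin E n x) = barDLin G n (barMap f (n + 1) x) := by
  induction x using Finsupp.induction_linear with
  | zero => simp
  | add x y hx hy => simp [hx, hy]
  | single p m =>
    have h1 : (Finsupp.single p m : Bar E (n + 1)) = m • Finsupp.single p 1 := by simp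
    rw [h1, map_smul, map_smul, map_smul, map_smul, barDLin_single, barMap_single, barDLin_single]
    have h : ∀ j : Fin (n + 1),
        (fun i => f (Fin.contractNth j (· * ·) p.2 i))
          = Fin.contractNth j (· * ·) (fun i => f (p.2 i)) := fun j =>
      Fin.comp_contractNth (f := f) (· * ·) (· * ·) (fun x y => map_mul f x y) j p.2
    simp [barBd, barMap_single, h]
    rfl

lemma barMap_barRho (f : E →*[Γ] G) (n : ℕ) (a : SProd Γ E) (x : Bar E n) :
    barMap f n (barRho Γ E n a x) = barRho Γ G n ⟨f a.left, a.right⟩ (barMap f n x) := by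
  induction x using Finsupp.induction_linear with
  | zero => simp
  | add x y hx hy => simp [hx, hy]
  | single p m => simp [barRho_single, barMap_single, barAct, map_smul]

/-- The map induced by `f` on the complexes of coinvariants. -/
def chainsMap (f : E →*[Γ] G) (n : ℕ) :
    (barResolution Γ E).Chains n →ₗ[ℤ] (barResolution Γ G).Chains n :=
  Representation.Coinvariants.lift (barRho Γ E n)
    (Representation.Coinvariants.mk (barRho Γ G n) ∘ₗ barMap f n) fun a => by
      apply LinearMap.ext
      intro x
      change Representation.Coinvariants.mk (barRho Γ G n) (barMap f n (barRho Γ E n a x)) = _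
      rw [barMap_barRho]
      exact Representation.Coinvariants.mk_self_apply (barRho Γ G n) _ _

lemma chainsMap_dC (f : E →*[Γ] G) (n : ℕ) (x : (barResolution Γ E).Chains (n + 1)) :
    chainsMap f n ((barResolution Γ E).dC n x)
      = (barResolution Γ G).dC n (chainsMap f (n + 1) x) := by
  induction x using Representation.Coinvariants.induction_on with
  | h v => exact congrArg (Representation.Coinvariants.mk (barRho Γ G n)) (barMap_barD f n v)

lemma chainsMap_cycles (f : E →*[Γ] G) (n : ℕ) (x : (barResolution Γ E).Chains n)
    (hx : x ∈ (barResolution Γ E).cycles n) :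
    chainsMap f n x ∈ (barResolution Γ G).cycles n := by
  cases n with
  | zero => trivial
  | succ n =>
    have h := chainsMap_dC f n x
    rw [show (barResolution Γ E).dC n x = 0 from hx, map_zero] at h
    exact h.symm

/-- The homomorphism `H_n^Γ(E) → H_n^Γ(G)` induced by a morphism `f : E → G` of `Γ`-groups. -/
def H.map (f : E →*[Γ] G) (n : ℕ) : H Γ E n →ₗ[ℤ] H Γ G n :=
  Submodule.mapQ _ _ ((chainsMap f n).restrict (chainsMap_cycles f n)) (by
    rintro ⟨_, hx⟩ ⟨y, rfl⟩
    exact ⟨chainsMap f (n + 1) y, (chainsMap_dC f n y).symm⟩)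

/-- The class of the cycle `[g]` in `H_1^Γ(G)`; this is the natural map `G → H_1^Γ(G)`. -/
def H.cls (Γ : Type w) [Group Γ] {G : Type u} [Group G] [MulDistribMulAction Γ G] (g : G) :
    H Γ G 1 :=
  Submodule.Quotient.mk
    ⟨Representation.Coinvariants.mk (barRho Γ G 1) (Finsupp.single ((1 : G), fun _ => g) 1), by
      change Representation.Coinvariants.mk (barRho Γ G 0) (barDLin G 0 _) = 0
      rw [barDLin_single, Representation.Coinvariants.mk_eq_zero]
      refine Representation.Coinvariants.mem_ker_of_eq (SemidirectProduct.inl g)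
        (Finsupp.single (1, Fin.elim0) 1) _ ?_
      rw [barRho_single]
      simp only [barBd, barAct, sub_eq_add_neg, SemidirectProduct.left_inl,
        SemidirectProduct.right_inl, one_smul, mul_one, one_mul]
      simp
      refine congrArg₂ (· + ·) ?_ (congrArg Neg.neg ?_) <;>
      · congr 2
        exact Subsingleton.elim _ _⟩

end Homology

/-! ### Equivariant commutators and projective presentations -/

section Commutators

/-- The subgroup `[G, S]_Γ` of `G` generated by the elements `x · σy · x⁻¹ · y⁻¹` with `x ∈ G`,
`y ∈ S` and `σ ∈ Γ`. -/
def gammaComm (Γ : Type*) [Group Γ] {G : Type*} [Group G] [MulDistribMulAction Γ G]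
    (S : Subgroup G) : Subgroup G :=
  Subgroup.closure {z | ∃ x : G, ∃ y ∈ S, ∃ σ : Γ, z = x * σ • y * x⁻¹ * y⁻¹}

instance gammaComm_normal (Γ : Type*) [Group Γ] {G : Type*} [Group G] [MulDistribMulAction Γ G]
    (S : Subgroup G) : (gammaComm Γ S).Normal := by
  refine ⟨fun z hz g => ?_⟩
  have key : gammaComm Γ S ≤ (gammaComm Γ S).comap (MulAut.conj g).toMonoidHom := by
    refine (Subgroup.closure_le _).2 ?_
    rintro _ ⟨x, y, hy, σ, rfl⟩
    have h1 : g * x * σ • y * (g * x)⁻¹ * y⁻¹ ∈ gammaComm Γ S :=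
      Subgroup.subset_closure ⟨g * x, y, hy, σ, rfl⟩
    have h2 : g * (1 : Γ) • y * g⁻¹ * y⁻¹ ∈ gammaComm Γ S :=
      Subgroup.subset_closure ⟨g, y, hy, 1, rfl⟩
    have h3 := mul_mem h1 (inv_mem h2)
    simpa [mul_assoc] using h3
  simpa using key hz

variable {Γ : Type*} [Group Γ] {P E G : Type*} [Group P] [MulDistribMulAction Γ P]
  [Group E] [MulDistribMulAction Γ E] [Group G] [MulDistribMulAction Γ G]

/-- The kernel of a morphism of `Γ`-groups. -/
abbrev gker (f : E →*[Γ] G) : Subgroup E := f.toMonoidHom.ker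

/-- `f` has a `Γ`-equivariant section (a map of `Γ`-sets, not necessarily a homomorphism). -/
def HasGammaSection (f : E →*[Γ] G) : Prop :=
  ∃ s : G → E, (∀ (σ : Γ) (g : G), s (σ • g) = σ • s g) ∧ ∀ g, f (s g) = g

/-- `P` is projective for the free cotriple on `Γ`-groups: the canonical `Γ`-homomorphism
`FreeGroup P → P`, `|p| ↦ p`, has a section which is a `Γ`-homomorphism; here `Γ` acts on
`FreeGroup P` by `σ|p| = |σp|`. Equivalently, `P` is a retract of a `Γ`-free group. -/
def IsGammaProjective (Γ : Type*) [Group Γ] (P : Type*) [Group P] [MulDistribMulAction Γ P] :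
    Prop :=
  ∃ s : P →* FreeGroup P,
    (∀ (σ : Γ) (p : P), s (σ • p) = FreeGroup.map (fun q : P => σ • q) (s p)) ∧
    ∀ p, FreeGroup.lift (fun q : P => q) (s p) = p

/-- `τ : P → E` is a projective presentation of the `Γ`-group `E`. -/
def IsProjectivePresentation (τ : P →*[Γ] E) : Prop :=
  IsGammaProjective Γ P ∧ HasGammaSection τ

lemma gammaComm_le_comap (τ : P →*[Γ] E) {S : Subgroup P} {T : Subgroup E}
    (h : ∀ y ∈ S, τ y ∈ T) : gammaComm Γ S ≤ (gammaComm Γ T).comap τ.toMonoidHom := by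
  refine (Subgroup.closure_le _).2 ?_
  rintro _ ⟨x, y, hy, σ, rfl⟩
  refine Subgroup.subset_closure ⟨τ x, τ y, h y hy, σ, ?_⟩
  change τ _ = _
  simp [map_smul]

lemma gammaComm_gker_le (τ : P →*[Γ] E) : gammaComm Γ (gker τ) ≤ gker τ := by
  refine (Subgroup.closure_le _).2 ?_
  rintro _ ⟨x, y, hy, σ, rfl⟩
  have hy' : τ y = 1 := hy
  change τ _ = 1
  simp [map_smul, hy']

variable (τ : P →*[Γ] E) (α : E →*[Γ] G)

/-- With `R = Ker τ`, `S = Ker (α ∘ τ)` and `N = Ker α`, the homomorphism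
`[P, S]_Γ / [P, R]_Γ → [E, N]_Γ` induced by `τ`. -/
def commQuotMap :
    (gammaComm Γ (gker (α.comp τ)) ⧸
      (gammaComm Γ (gker τ)).subgroupOf (gammaComm Γ (gker (α.comp τ)))) →*
    gammaComm Γ (gker α) :=
  QuotientGroup.lift _
    ((τ.toMonoidHom.comp (gammaComm Γ (gker (α.comp τ))).subtype).codRestrict
      (gammaComm Γ (gker α)) fun x =>
        gammaComm_le_comap τ (S := gker (α.comp τ)) (T := gker α) (fun _ hy => hy) x.2)
    (by
      intro x hx
      exact Subtype.ext (gammaComm_gker_le τ hx))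

/-- The group `U`: the kernel of `[P, S]_Γ / [P, R]_Γ → [E, N]_Γ`. -/
abbrev U := (commQuotMap τ α).ker

/-- For a morphism `i : N → E` of `Γ`-groups, used when `i` embeds `N` as a normal subgroup of `E`:
the subgroup `[E, N]_Γ`, viewed as a subgroup of `N`. -/
abbrev commIn {N : Type*} [Group N] [MulDistribMulAction Γ N] (i : N →*[Γ] E) : Subgroup N :=
  (gammaComm Γ i.toMonoidHom.range).comap i.toMonoidHom

end Commutators

end EquivHomology

end

/-! The carrier of the proof is an equivariant Hopf formula: for a projective presentation `P → E`
with kernel `R`, $H_2^\Gamma(E)\cong(R\cap[P,P]_\Gamma)/[P,R]_\Gamma$, naturally in $E$. In degree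
one, $H_1^\Gamma(E)\cong E/[E,E]_\Gamma$ (`clsHom_surjective`, `ker_clsHom`).

The Hopf map sends $[a,b]$ to the factor $s(a)s(b)s(ab)^{-1}$ of an equivariant section $s$, read in
$P/[P,R]_\Gamma$, where $R$ becomes central with trivial action. A comparison extension `BarExt` of
$E$ by 2-chains modulo boundaries, with cocycle $[a,b]$, gives bijectivity. By projectivity `P → E`
lifts to `BarExt`; the lift factors through $P/[P,R]_\Gamma$ and undoes the Hopf map
(`hopf_injective`). Conversely $s$ defines a homomorphism from `BarExt` to $P/[P,R]_\Gamma$, which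
recovers each element of $R\cap[P,P]_\Gamma$ (`exists_hopf_of_mem`).

The same $P$ presents $G$, with kernel $S\supseteq R$ and $S/R\cong N$, and $\tau$ maps
$[P,S]_\Gamma$ onto $[E,N]_\Gamma$. By naturality (`coverMap_hopf`), $H_2^\Gamma(E)\to
H_2^\Gamma(G)$ is the map from $(R\cap[P,P]_\Gamma)/[P,R]_\Gamma$ to
$(S\cap[P,P]_\Gamma)/[P,S]_\Gamma$. Its kernel is $(R\cap[P,S]_\Gamma)/[P,R]_\Gamma=U$, and $\delta$
is induced by $\tau$. Exactness is then a computation with subgroups of $P$ and $E$. -/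

noncomputable section

namespace EquivHomology

open scoped IsMulCommutative

/-! ### The chains as a free abelian group on orbits -/

section Chains

variable {Γ : Type w} [Group Γ] {E : Type u} [Group E] [MulDistribMulAction Γ E]

variable (Γ) in
/-- The class of the symbol `[v₁, …, vₙ]` in the chains of the bar resolution. -/
def symb {n : ℕ} (v : Fin n → E) : (barResolution Γ E).Chains n :=
  Representation.Coinvariants.mk (barRho Γ E n) (Finsupp.single (1, v) 1)

lemma mk_single {n : ℕ} (g : E) (v : Fin n → E) (m : ℤ) :
    Representation.Coinvariants.mk (barRho Γ E n) (Finsupp.single (g, v) m) = m • symb Γ v := by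
  have h : Finsupp.single (g, v) m =
      barRho Γ E n (SemidirectProduct.inl g) (m • Finsupp.single (1, v) 1) := by
    rw [map_smul, barRho_single]
    simp [barAct]
  rw [h]
  exact (Representation.Coinvariants.mk_self_apply (barRho Γ E n) _ _).trans (map_smul _ _ _)

lemma symb_smul {n : ℕ} (σ : Γ) (v : Fin n → E) : symb Γ (fun i => σ • v i) = symb Γ v := by
  have h : (Finsupp.single (1, fun i => σ • v i) 1 : Bar E n) =
      barRho Γ E n (SemidirectProduct.inr σ) (Finsupp.single (1, v) 1) := by
    rw [barRho_single]
    simp [barAct]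
  unfold symb
  rw [h]
  exact Representation.Coinvariants.mk_self_apply (barRho Γ E n) _ _

/-- Coinvariants absorb the coefficient in $E$, so the symbols generate. Stating this for predicates
allows existential claims about chains and identities in noncommutative groups, to which
`chains_ext` does not apply. -/
lemma chains_induction {n : ℕ} {p : (barResolution Γ E).Chains n → Prop} (zero : p 0)
    (add : ∀ x y, p x → p y → p (x + y)) (neg : ∀ x, p x → p (-x))
    (symb : ∀ v : Fin n → E, p (symb Γ v)) (x : (barResolution Γ E).Chains n) : p x := by
  let T : AddSubgroup (barRho Γ E n).Coinvariants :=
    { carrier := {x | p x}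
      zero_mem' := zero
      add_mem' := fun {x y} => add x y
      neg_mem' := fun {x} => neg x }
  have key : ∀ y : Bar E n, Representation.Coinvariants.mk (barRho Γ E n) y ∈ T := fun y => by
    induction y using Finsupp.induction_linear with
    | zero => rw [map_zero]; exact zero_mem T
    | add x y hx hy => rw [map_add]; exact add_mem hx hy
    | single q m =>
      rw [show Representation.Coinvariants.mk (barRho Γ E n) (Finsupp.single q m) =
        m • EquivHomology.symb Γ q.2 from mk_single q.1 q.2 m]
      exact T.zsmul_mem (symb q.2) m
  induction x using Representation.Coinvariants.induction_on with
  | h y => exact key y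

lemma chains_ext {n : ℕ} {A : Type*} [AddCommGroup A]
    {f g : (barResolution Γ E).Chains n →ₗ[ℤ] A}
    (h : ∀ v : Fin n → E, f (symb Γ v) = g (symb Γ v)) : f = g := by
  ext1
  refine Finsupp.lhom_ext fun q m => ?_
  change f (Representation.Coinvariants.mk (barRho Γ E n) _) =
    g (Representation.Coinvariants.mk (barRho Γ E n) _)
  rw [mk_single, map_smul, map_smul, h]

/-- A `Γ`-invariant function of `n` elements of `E` extends to the chains of degree `n`. -/
def chainsLift {n : ℕ} {A : Type*} [AddCommGroup A] (f : (Fin n → E) → A)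
    (hf : ∀ (σ : Γ) v, f (fun i => σ • v i) = f v) : (barResolution Γ E).Chains n →ₗ[ℤ] A :=
  Representation.Coinvariants.lift (barRho Γ E n)
    (Finsupp.linearCombination ℤ fun q => f q.2) fun a => by
      refine Finsupp.lhom_ext fun q m => ?_
      change Finsupp.linearCombination ℤ _ (barRho Γ E n a _) = _
      rw [barRho_single]
      simp [barAct, hf]

lemma chainsLift_symb {n : ℕ} {A : Type*} [AddCommGroup A] (f : (Fin n → E) → A)
    (hf : ∀ (σ : Γ) v, f (fun i => σ • v i) = f v) (v : Fin n → E) :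
    chainsLift f hf (symb Γ v) = f v := by
  change Finsupp.linearCombination ℤ (fun q : E × (Fin n → E) => f q.2) _ = _
  simp

lemma dC_symb (n : ℕ) (v : Fin (n + 1) → E) :
    (barResolution Γ E).dC n (symb Γ v) = symb Γ (Fin.tail v) +
      ∑ j : Fin (n + 1), (-1 : ℤ) ^ ((j : ℕ) + 1) • symb Γ (Fin.contractNth j (· * ·) v) := by
  change Representation.Coinvariants.mk (barRho Γ E n) (barDLin E n (Finsupp.single (1, v) 1)) = _
  rw [barDLin_single, barBd, map_add, map_sum, mk_single, one_smul]
  simp only [mk_single]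
  rfl

/-- The two faces of $[a]$ are the empty symbol with opposite signs; hence every 1-chain is a cycle.
-/
lemma dC_zero_eq_zero : (barResolution Γ E).dC 0 = 0 := by
  refine chains_ext fun v => ?_
  have h : ∀ x y : Fin 0 → E, x = y := fun x y => Subsingleton.elim _ _
  rw [dC_symb, h (Fin.tail v) (Fin.contractNth 0 (· * ·) v)]
  simp

lemma dC_one_symb (a b : E) : (barResolution Γ E).dC 1 (symb Γ ![a, b]) =
    symb Γ ![b] - symb Γ ![a * b] + symb Γ ![a] := by
  have h0 : Fin.contractNth 0 (· * ·) ![a, b] = ![a * b] := by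
    ext i; fin_cases i; simp [Fin.contractNth]
  have h1 : Fin.contractNth 1 (· * ·) ![a, b] = ![a] := by
    ext i; fin_cases i; simp [Fin.contractNth]
  have ht : Fin.tail ![a, b] = ![b] := rfl
  rw [dC_symb, Fin.sum_univ_two, h0, h1, ht]
  simp
  abel

lemma dC_two_symb (a b c : E) : (barResolution Γ E).dC 2 (symb Γ ![a, b, c]) =
    symb Γ ![b, c] - symb Γ ![a * b, c] + symb Γ ![a, b * c] - symb Γ ![a, b] := by
  have h0 : Fin.contractNth 0 (· * ·) ![a, b, c] = ![a * b, c] := by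
    ext i; fin_cases i <;> simp [Fin.contractNth]
  have h1 : Fin.contractNth 1 (· * ·) ![a, b, c] = ![a, b * c] := by
    ext i; fin_cases i <;> simp [Fin.contractNth]
  have h2 : Fin.contractNth 2 (· * ·) ![a, b, c] = ![a, b] := by
    ext i; fin_cases i <;> simp [Fin.contractNth]
  have ht : Fin.tail ![a, b, c] = ![b, c] := rfl
  rw [dC_symb, Fin.sum_univ_three, h0, h1, h2, ht]
  simp
  abel

lemma dC_dC (n : ℕ) (x : (barResolution Γ E).Chains (n + 2)) :
    (barResolution Γ E).dC n ((barResolution Γ E).dC (n + 1) x) = 0 := by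
  induction x using Representation.Coinvariants.induction_on with
  | h y =>
    exact (congrArg (Representation.Coinvariants.mk (barRho Γ E n)) (barD_barD E n y)).trans
      (map_zero _)

lemma chainsMap_symb {G : Type v} [Group G] [MulDistribMulAction Γ G] (f : E →*[Γ] G) {n : ℕ}
    (v : Fin n → E) : chainsMap f n (symb Γ v) = symb Γ (fun i => f (v i)) := by
  change Representation.Coinvariants.mk (barRho Γ G n) (barMap f n _) = _
  rw [barMap_single, mk_single, one_smul]

end Chains

/-! ### Homology in degree one -/

section DegreeOne

variable {Γ : Type*} [Group Γ] {E : Type*} [Group E] [MulDistribMulAction Γ E]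
  {G : Type*} [Group G] [MulDistribMulAction Γ G]

lemma commutator_mem_gammaComm {S : Subgroup E} (x : E) {y : E} (hy : y ∈ S) :
    x * y * x⁻¹ * y⁻¹ ∈ gammaComm Γ S :=
  Subgroup.subset_closure ⟨x, y, hy, 1, by rw [one_smul]⟩

lemma smul_mul_inv_mem_gammaComm {S : Subgroup E} (σ : Γ) {y : E} (hy : y ∈ S) :
    σ • y * y⁻¹ ∈ gammaComm Γ S :=
  Subgroup.subset_closure ⟨1, y, hy, σ, by simp⟩

lemma gammaComm_mono {S T : Subgroup E} (h : S ≤ T) : gammaComm Γ S ≤ gammaComm Γ T :=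
  Subgroup.closure_mono fun _ ⟨x, y, hy, σ, hz⟩ => ⟨x, y, h hy, σ, hz⟩

/-- A `Γ`-invariant homomorphism to a commutative group kills `[E, S]_Γ`. -/
lemma gammaComm_le_ker {A : Type*} [CommGroup A] (f : E →* A) (hf : ∀ (σ : Γ) x, f (σ • x) = f x)
    (S : Subgroup E) : gammaComm Γ S ≤ f.ker := by
  refine (Subgroup.closure_le _).2 ?_
  rintro _ ⟨x, y, -, σ, rfl⟩
  simp [MonoidHom.mem_ker, hf]

lemma map_gammaComm (f : E →*[Γ] G) (hf : Function.Surjective f) (S : Subgroup E) :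
    (gammaComm Γ S).map f.toMonoidHom = gammaComm Γ (S.map f.toMonoidHom) := by
  refine le_antisymm ?_ ?_
  · exact Subgroup.map_le_iff_le_comap.2 (gammaComm_le_comap f fun y hy => ⟨y, hy, rfl⟩)
  · refine (Subgroup.closure_le _).2 ?_
    rintro _ ⟨x, _, ⟨y, hy, rfl⟩, σ, rfl⟩
    obtain ⟨x, rfl⟩ := hf x
    refine ⟨x * σ • y * x⁻¹ * y⁻¹, Subgroup.subset_closure ⟨x, y, hy, σ, rfl⟩, ?_⟩
    change f _ = f x * σ • f y * (f x)⁻¹ * (f y)⁻¹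
    simp [map_smul]

/-- The quotient `E / [E, E]_Γ` is commutative. -/
instance gammaAbelianization : CommGroup (E ⧸ gammaComm Γ (⊤ : Subgroup E)) :=
  { QuotientGroup.Quotient.group (gammaComm Γ (⊤ : Subgroup E)) with
    mul_comm := by
      rintro ⟨x⟩ ⟨y⟩
      refine (QuotientGroup.eq (s := gammaComm Γ (⊤ : Subgroup E))).2 ?_
      have := commutator_mem_gammaComm (Γ := Γ) (S := ⊤) y⁻¹ (Subgroup.mem_top x⁻¹)
      simpa [mul_assoc] using this }

lemma mk_smul_eq {S : Subgroup E} (σ : Γ) {y : E} (hy : y ∈ S) :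
    ((σ • y : E) : E ⧸ gammaComm Γ S) = y := by
  have h := (QuotientGroup.eq_one_iff _).2 (smul_mul_inv_mem_gammaComm σ hy)
  rw [QuotientGroup.mk_mul, QuotientGroup.mk_inv] at h
  exact mul_inv_eq_one.1 h

/-- The generators with $\sigma=1$ are the commutators of $E$ with $S$; those with $x=1$, used in
`mk_smul_eq`, trivialize the action on $S$. -/
lemma mk_mem_center {S : Subgroup E} {y : E} (hy : y ∈ S) :
    (y : E ⧸ gammaComm Γ S) ∈ Subgroup.center (E ⧸ gammaComm Γ S) := by
  refine Subgroup.mem_center_iff.2 ?_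
  rintro ⟨x⟩
  have h := (QuotientGroup.eq_one_iff _).2 (commutator_mem_gammaComm (Γ := Γ) x hy)
  rw [QuotientGroup.mk_mul, QuotientGroup.mk_inv, mul_inv_eq_one, QuotientGroup.mk_mul,
    QuotientGroup.mk_inv, mul_inv_eq_iff_eq_mul] at h
  exact h

variable (Γ) in
/-- The natural homomorphism `E → H_1^Γ(E)`. -/
def clsHom (E : Type*) [Group E] [MulDistribMulAction Γ E] : E →* Multiplicative (H Γ E 1) :=
  MonoidHom.mk' (fun e => Multiplicative.ofAdd (H.cls Γ e)) fun a b => by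
    rw [← ofAdd_add]
    refine congrArg Multiplicative.ofAdd ?_
    refine (Submodule.Quotient.eq _).2 ⟨-symb Γ ![a, b], ?_⟩
    have hv : ∀ g : E, (fun _ => g) = ![g] := fun g => by ext i; fin_cases i; rfl
    rw [map_neg, dC_one_symb]
    change _ = symb Γ (fun _ => a * b) - (symb Γ (fun _ => a) + symb Γ (fun _ => b))
    rw [hv, hv, hv]
    abel

lemma H.map_cls (f : E →*[Γ] G) (e : E) : H.map f 1 (H.cls Γ e) = H.cls Γ (f e) := by
  refine congrArg Submodule.Quotient.mk (Subtype.ext ?_)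
  exact chainsMap_symb f _

/-- Since $[a]+[b]$ is homologous to $[ab]$, a sum of symbols collapses to a single one. -/
lemma clsHom_surjective : Function.Surjective (clsHom Γ E) := by
  have key : ∀ x : (barResolution Γ E).Chains 1, ∃ e, ∀ hx,
      H.cls Γ e = Submodule.Quotient.mk ⟨x, hx⟩ := by
    have hc : ∀ x : (barResolution Γ E).Chains 1, x ∈ (barResolution Γ E).cycles 1 := fun x => by
      change (barResolution Γ E).dC 0 x = 0
      rw [dC_zero_eq_zero, LinearMap.zero_apply]
    intro x
    induction x using chains_induction with
    | zero => exact ⟨1, fun _ => congrArg Multiplicative.toAdd (map_one (clsHom Γ E))⟩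
    | add x y hx hy =>
      obtain ⟨a, ha⟩ := hx
      obtain ⟨b, hb⟩ := hy
      refine ⟨a * b, fun h => ?_⟩
      refine (congrArg Multiplicative.toAdd (map_mul (clsHom Γ E) a b)).trans ?_
      exact congrArg₂ (· + ·) (ha (hc x)) (hb (hc y))
    | neg x hx =>
      obtain ⟨a, ha⟩ := hx
      refine ⟨a⁻¹, fun h => ?_⟩
      refine (congrArg Multiplicative.toAdd (map_inv (clsHom Γ E) a)).trans ?_
      exact congrArg Neg.neg (ha (hc x))
    | symb v =>
      refine ⟨v 0, fun h => congrArg Submodule.Quotient.mk (Subtype.ext ?_)⟩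
      refine congrArg (symb Γ) ?_
      ext i
      fin_cases i
      rfl
  intro x
  obtain ⟨⟨x, hx⟩, rfl⟩ := Submodule.Quotient.mk_surjective _ x.toAdd
  obtain ⟨e, he⟩ := key x
  exact ⟨e, he hx⟩

/-- The map on chains of degree `1` that sends `[p]` to the class of `s(p)` modulo `[P, P]_Γ`. -/
def chainsToGammaAb {P : Type*} [Group P] [MulDistribMulAction Γ P] (s : E → P)
    (hs : ∀ (σ : Γ) e, s (σ • e) = σ • s e) :
    (barResolution Γ E).Chains 1 →ₗ[ℤ] Additive (P ⧸ gammaComm Γ (⊤ : Subgroup P)) :=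
  chainsLift (fun v => Additive.ofMul (s (v 0) : P ⧸ gammaComm Γ (⊤ : Subgroup P)))
    fun σ v => by rw [hs, mk_smul_eq σ (Subgroup.mem_top _)]

/-- The map $[e]\mapsto e$ from 1-chains to $E/[E,E]_\Gamma$ kills every $\partial[a,b]$, so a class
that vanishes in homology vanishes there. The other inclusion holds because the class is
$\Gamma$-invariant with values in a commutative group. -/
lemma ker_clsHom : (clsHom Γ E).ker = gammaComm Γ (⊤ : Subgroup E) := by
  refine le_antisymm (fun e he => ?_) (gammaComm_le_ker _ (fun σ x => ?_) _)
  · obtain ⟨y, hy⟩ := (Submodule.Quotient.mk_eq_zero _).1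
      (show H.cls Γ e = 0 from congrArg Multiplicative.toAdd he)
    have h0 : chainsToGammaAb (Γ := Γ) (fun x : E => x) (fun _ _ => rfl) ∘ₗ
        (barResolution Γ E).dC 1 = 0 := by
      refine chains_ext fun v => ?_
      obtain ⟨a, b, rfl⟩ : ∃ a b, v = ![a, b] := ⟨v 0, v 1, by ext i; fin_cases i <;> rfl⟩
      rw [LinearMap.comp_apply, dC_one_symb, map_add, map_sub]
      simp only [chainsToGammaAb, chainsLift_symb]
      change Additive.ofMul ((b : E ⧸ gammaComm Γ (⊤ : Subgroup E)) / (a * b : E) * a) = 0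
      rw [QuotientGroup.mk_mul, mul_comm (a : E ⧸ gammaComm Γ (⊤ : Subgroup E))]
      simp
    have h1 := LinearMap.congr_fun h0 y
    rw [LinearMap.comp_apply, hy] at h1
    have h2 : chainsToGammaAb (Γ := Γ) (fun x : E => x) (fun _ _ => rfl)
        (symb Γ fun _ => e) = 0 := h1
    rw [chainsToGammaAb, chainsLift_symb] at h2
    exact (QuotientGroup.eq_one_iff _).1 (congrArg Additive.toMul h2)
  · refine congrArg Multiplicative.ofAdd (congrArg Submodule.Quotient.mk (Subtype.ext ?_))
    exact symb_smul σ fun _ => x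

end DegreeOne

/-! ### The Hopf homomorphism -/

section Hopf

variable {Γ P E G : Type*} [Group Γ] [Group P] [MulDistribMulAction Γ P]
  [Group E] [MulDistribMulAction Γ E] [Group G] [MulDistribMulAction Γ G]

/-- Changing a section by central elements changes its factor set by a coboundary; the order `y / z
* x` matches $\partial[a,b]=[b]-[ab]+[a]$. -/
lemma center_mul_factor {Q : Type*} [Group Q] (x y z : Subgroup.center Q) (a b c : Q) :
    x * a * (y * b) * (z * c)⁻¹ = ((y / z * x : Subgroup.center Q) : Q) * (a * b * c⁻¹) := by
  have hy := Subgroup.mem_center_iff.1 y.2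
  have hz := Subgroup.mem_center_iff.1 z⁻¹.2
  rw [div_eq_mul_inv, mul_comm _ x, mul_comm y, Subgroup.coe_mul, Subgroup.coe_mul, mul_inv_rev,
    ← InvMemClass.coe_inv, ← mul_assoc, hz]
  simp only [mul_assoc]
  rw [← mul_assoc a, hy a, ← mul_assoc (↑z⁻¹ : Q) x, ← hz x]
  simp only [mul_assoc]

/-- A `Γ`-equivariant section of `τ`. -/
structure GammaSection (τ : P →*[Γ] E) where
  /-- the section -/
  toFun : E → P
  map_smul' : ∀ (σ : Γ) e, toFun (σ • e) = σ • toFun e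
  right_inv' : ∀ e, τ (toFun e) = e

/-- The quotient of `P` by `[P, Ker τ]_Γ`. -/
abbrev Cover (τ : P →*[Γ] E) : Type _ := P ⧸ gammaComm Γ (gker τ)

/-- The homomorphism from the kernel of `τ` to the center of `P / [P, Ker τ]_Γ`. -/
def kerToCenter (τ : P →*[Γ] E) : gker τ →* Subgroup.center (Cover τ) :=
  ((QuotientGroup.mk' (gammaComm Γ (gker τ))).comp (gker τ).subtype).codRestrict _
    fun x => mk_mem_center x.2

lemma kerToCenter_smul (τ : P →*[Γ] E) (σ : Γ) {x y : P} (hx : x ∈ gker τ) (hy : y ∈ gker τ)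
    (h : y = σ • x) : kerToCenter τ ⟨y, hy⟩ = kerToCenter τ ⟨x, hx⟩ := by
  subst h
  exact Subtype.ext (mk_smul_eq σ hx)

/-- The projection `P / [P, R]_Γ → P / [P, S]_Γ` for `R ≤ S`. -/
def coverMap (τ : P →*[Γ] E) (α : E →*[Γ] G) :
    Cover τ →* Cover (α.comp τ) :=
  QuotientGroup.map _ _ (MonoidHom.id P) (gammaComm_mono fun x (hx : τ x = 1) => by
    change α (τ x) = 1
    rw [hx, map_one])

namespace GammaSection

variable {τ : P →*[Γ] E} (s : GammaSection τ)

/-- The factor `s(a) s(b) s(ab)⁻¹` of the section. -/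
def factor (a b : E) : gker τ :=
  ⟨s.toFun a * s.toFun b * (s.toFun (a * b))⁻¹, by
    change τ _ = 1
    simp [s.right_inv']⟩

/-- The map on chains of degree `2` given by the factor set of the section. -/
def hopfChains : (barResolution Γ E).Chains 2 →ₗ[ℤ] Additive (Subgroup.center (Cover τ)) :=
  chainsLift (fun v => Additive.ofMul (kerToCenter τ (s.factor (v 0) (v 1)))) fun σ v => by
    refine congrArg Additive.ofMul (kerToCenter_smul τ σ _ _ ?_)
    simp [← s.map_smul']

lemma hopfChains_symb (a b : E) :
    s.hopfChains (symb Γ ![a, b]) = Additive.ofMul (kerToCenter τ (s.factor a b)) := by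
  rw [hopfChains, chainsLift_symb]
  rfl

lemma coe_hopfChains_symb (a b : E) :
    ((s.hopfChains (symb Γ ![a, b])).toMul : Cover τ) =
      (s.toFun a : Cover τ) * s.toFun b * (s.toFun (a * b) : Cover τ)⁻¹ := by
  rw [hopfChains_symb]
  rfl

/-- This is the cocycle identity of a factor set: both sides equal $s(a)s(b)s(c)s(abc)^{-1}$, once
the central factor of $(b,c)$ is moved past $s(a)$. -/
lemma hopfChains_dC (y : (barResolution Γ E).Chains 3) :
    s.hopfChains ((barResolution Γ E).dC 2 y) = 0 := by
  have h : s.hopfChains ∘ₗ (barResolution Γ E).dC 2 = 0 := by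
    refine chains_ext fun v => ?_
    obtain ⟨a, b, c, rfl⟩ : ∃ a b c, v = ![a, b, c] :=
      ⟨v 0, v 1, v 2, by ext i; fin_cases i <;> rfl⟩
    rw [LinearMap.comp_apply, dC_two_symb, map_sub, map_add, map_sub, LinearMap.zero_apply,
      sub_eq_zero, sub_add_eq_add_sub, sub_eq_iff_eq_add]
    refine Additive.toMul.injective (Subtype.ext ?_)
    have hc := Subgroup.mem_center_iff.1 (s.hopfChains (symb Γ ![b, c])).toMul.2 (s.toFun a)
    calc ((s.hopfChains (symb Γ ![b, c])).toMul : Cover τ) *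
          (s.hopfChains (symb Γ ![a, b * c])).toMul
        = (s.toFun a * (s.hopfChains (symb Γ ![b, c])).toMul) *
            (s.toFun (b * c) * (s.toFun (a * (b * c)) : Cover τ)⁻¹) := by
          rw [hc, coe_hopfChains_symb s a]
          simp only [mul_assoc]
      _ = ((s.hopfChains (symb Γ ![a, b])).toMul : Cover τ) *
          (s.hopfChains (symb Γ ![a * b, c])).toMul := by
          simp only [coe_hopfChains_symb, mul_assoc, inv_mul_cancel_left]
  exact LinearMap.congr_fun h y

/-- A representative in $R$ is carried along because its class modulo $[P,P]_\Gamma$ depends only on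
$\partial z$. For a cycle it therefore lies in $R\cap[P,P]_\Gamma$, which bounds the image of the
Hopf map. -/
lemma exists_hopfChains_eq (z : (barResolution Γ E).Chains 2) :
    ∃ r ∈ gker τ, ((s.hopfChains z).toMul : Cover τ) = (r : Cover τ) ∧
      Additive.ofMul (r : P ⧸ gammaComm Γ (⊤ : Subgroup P)) =
        chainsToGammaAb s.toFun s.map_smul' ((barResolution Γ E).dC 1 z) := by
  induction z using chains_induction with
  | zero => exact ⟨1, one_mem _, by simp, by simp⟩
  | add x y hx hy =>
    obtain ⟨a, ha, ha', ha''⟩ := hx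
    obtain ⟨b, hb, hb', hb''⟩ := hy
    refine ⟨a * b, mul_mem ha hb, ?_, ?_⟩
    · rw [map_add, toMul_add, Subgroup.coe_mul, ha', hb', QuotientGroup.mk_mul]
    · rw [map_add, map_add, ← ha'', ← hb'', QuotientGroup.mk_mul, ofMul_mul]
  | neg x hx =>
    obtain ⟨a, ha, ha', ha''⟩ := hx
    refine ⟨a⁻¹, inv_mem ha, ?_, ?_⟩
    · rw [map_neg, toMul_neg, Subgroup.coe_inv, ha', QuotientGroup.mk_inv]
    · rw [map_neg, map_neg, ← ha'', QuotientGroup.mk_inv, ofMul_inv]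
  | symb v =>
    obtain ⟨a, b, rfl⟩ : ∃ a b, v = ![a, b] := ⟨v 0, v 1, by ext i; fin_cases i <;> rfl⟩
    refine ⟨s.factor a b, (s.factor a b).2, by rw [hopfChains_symb]; rfl, ?_⟩
    rw [dC_one_symb, map_add, map_sub]
    simp only [chainsToGammaAb, chainsLift_symb]
    change _ = Additive.ofMul ((s.toFun b : P ⧸ gammaComm Γ (⊤ : Subgroup P)) /
      s.toFun (a * b) * s.toFun a)
    refine congrArg Additive.ofMul ?_
    change (s.toFun a : P ⧸ gammaComm Γ (⊤ : Subgroup P)) *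
      (s.toFun b : P ⧸ gammaComm Γ (⊤ : Subgroup P)) * (s.toFun (a * b) :
      P ⧸ gammaComm Γ (⊤ : Subgroup P))⁻¹ = _
    rw [div_mul_eq_mul_div, div_eq_mul_inv,
      mul_comm (s.toFun a : P ⧸ gammaComm Γ (⊤ : Subgroup P))]

/-- The Hopf homomorphism `H_2^Γ(E) → P / [P, R]_Γ` of a section of `τ : P → E` with kernel `R`. -/
def hopf : H Γ E 2 →+ Additive (Cover τ) :=
  (MonoidHom.toAdditive (Subgroup.center (Cover τ)).subtype).comp
    (Submodule.liftQ _ (s.hopfChains ∘ₗ ((barResolution Γ E).cycles 2).subtype) (by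
      rintro ⟨_, hx⟩ ⟨y, rfl⟩
      exact s.hopfChains_dC y)).toAddMonoidHom

lemma exists_hopf_eq (x : H Γ E 2) :
    ∃ r ∈ gker τ ⊓ gammaComm Γ ⊤, (s.hopf x).toMul = (r : Cover τ) := by
  obtain ⟨⟨z, hz⟩, rfl⟩ := Submodule.Quotient.mk_surjective _ x
  obtain ⟨r, hr, h1, h2⟩ := s.exists_hopfChains_eq z
  rw [show (barResolution Γ E).dC 1 z = 0 from hz, map_zero] at h2
  exact ⟨r, ⟨hr, (QuotientGroup.eq_one_iff _).1 (congrArg Additive.toMul h2)⟩, h1⟩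

/-- The Hopf homomorphism is natural. -/
lemma coverMap_hopf (α : E →*[Γ] G) (t : GammaSection (α.comp τ)) (x : H Γ E 2) :
    coverMap τ α (s.hopf x).toMul = (t.hopf (H.map α 2 x)).toMul := by
  obtain ⟨⟨z, hz⟩, rfl⟩ := Submodule.Quotient.mk_surjective _ x
  -- Both $s(a)$ and $t(\alpha a)$ lie over $\alpha(a)$, so their quotient is central modulo
  -- $[P,S]_\Gamma$; `u` is this quotient as a 1-cochain.
  have hmem : ∀ a : E, s.toFun a * (t.toFun (α a))⁻¹ ∈ gker (α.comp τ) := fun a => by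
    have h1 : (α.comp τ) (t.toFun (α a)) = α a := t.right_inv' _
    have h2 : (α.comp τ) (s.toFun a) = α a := congrArg α (s.right_inv' a)
    change (α.comp τ) _ = 1
    rw [map_mul, map_inv, h1, h2, mul_inv_cancel]
  let u : (barResolution Γ E).Chains 1 →ₗ[ℤ] Additive (Subgroup.center (Cover (α.comp τ))) :=
    chainsLift (fun v => Additive.ofMul (kerToCenter (α.comp τ) ⟨_, hmem (v 0)⟩)) fun σ v => by
      refine congrArg Additive.ofMul (kerToCenter_smul _ σ _ _ ?_)
      simp [← s.map_smul', ← t.map_smul', map_smul]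
  have hu : ∀ a : E, (s.toFun a : Cover (α.comp τ)) =
      (u (symb Γ ![a])).toMul * (t.toFun (α a) : Cover (α.comp τ)) := fun a => by
    simp only [u, chainsLift_symb]
    change _ = (s.toFun a : Cover (α.comp τ)) * (t.toFun (α a) : Cover (α.comp τ))⁻¹ * _
    simp
  -- On arbitrary chains naturality holds up to the coboundary of `u`, which vanishes on cycles.
  have key : ∀ z : (barResolution Γ E).Chains 2, coverMap τ α (s.hopfChains z).toMul =
      (u ((barResolution Γ E).dC 1 z) + t.hopfChains (chainsMap α 2 z)).toMul := by
    intro z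
    induction z using chains_induction with
    | zero => simp
    | add x y hx hy =>
      simp only [map_add, toMul_add, Subgroup.coe_mul, map_mul] at hx hy ⊢
      rw [hx, hy]
      exact congrArg Subtype.val (mul_mul_mul_comm (G := Subgroup.center (Cover (α.comp τ))) _ _ _ _)
    | neg x hx =>
      simp only [map_neg, toMul_neg, toMul_add, Subgroup.coe_mul, Subgroup.coe_inv,
        map_inv] at hx ⊢
      rw [hx]
      exact congrArg Subtype.val (mul_inv (α := Subgroup.center _) _ _)
    | symb v =>
      obtain ⟨a, b, rfl⟩ : ∃ a b, v = ![a, b] := ⟨v 0, v 1, by ext i; fin_cases i <;> rfl⟩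
      have hv : (fun i => α (![a, b] i)) = ![α a, α b] := by ext i; fin_cases i <;> rfl
      rw [chainsMap_symb, hv, coe_hopfChains_symb, dC_one_symb, toMul_add, Subgroup.coe_mul,
        coe_hopfChains_symb, ← map_mul α]
      change (s.toFun a : Cover (α.comp τ)) * s.toFun b * (s.toFun (a * b) : Cover (α.comp τ))⁻¹ = _
      rw [hu a, hu b, hu (a * b), map_add, map_sub]
      exact center_mul_factor _ _ _ _ _ _
  have h := key z
  rw [show (barResolution Γ E).dC 1 z = 0 from hz, map_zero, zero_add] at h
  exact h

end GammaSection

end Hopf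

/-! ### The universal central extension cocycle -/

section BarExt

variable {Γ : Type*} [Group Γ] {E : Type*} [Group E] [MulDistribMulAction Γ E]

variable (Γ E) in
/-- The chains of degree `2` modulo boundaries. -/
abbrev BarCoker : Type _ := (barResolution Γ E).Chains 2 ⧸ (barResolution Γ E).boundaries 2

variable (Γ) in
/-- The class of `[a, b]` modulo boundaries, a `2`-cocycle of `E`. -/
def barCocycle (a b : E) : BarCoker Γ E := Submodule.Quotient.mk (symb Γ ![a, b])

lemma barCocycle_add (a b c : E) : barCocycle Γ b c + barCocycle Γ a (b * c) =
    barCocycle Γ a b + barCocycle Γ (a * b) c := by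
  unfold barCocycle
  rw [← Submodule.Quotient.mk_add, ← Submodule.Quotient.mk_add, Submodule.Quotient.eq]
  refine ⟨symb Γ ![a, b, c], ?_⟩
  rw [dC_two_symb]
  abel

lemma barCocycle_smul (σ : Γ) (a b : E) : barCocycle Γ (σ • a) (σ • b) = barCocycle Γ a b := by
  refine congrArg Submodule.Quotient.mk ((congrArg (symb Γ) ?_).trans (symb_smul σ ![a, b]))
  ext i
  fin_cases i <;> rfl

/-- The bar complex is unnormalized, so $[1,a]$ need not vanish modulo boundaries; only its
independence of $a$ is available. -/
lemma barCocycle_one_left (a : E) : barCocycle Γ 1 a = barCocycle Γ (1 : E) 1 := by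
  simpa using barCocycle_add (Γ := Γ) 1 1 a

variable (Γ E) in
/-- The central extension of `E` by the chains of degree `2` modulo boundaries whose cocycle is
`(a, b) ↦ [a, b]`. -/
@[ext]
structure BarExt where
  /-- the component in `E` -/
  base : E
  /-- the component in the kernel -/
  fib : BarCoker Γ E

namespace BarExt

instance : Mul (BarExt Γ E) :=
  ⟨fun x y => ⟨x.base * y.base, x.fib + y.fib + barCocycle Γ x.base y.base⟩⟩

/-- The shift compensates for the unnormalized cocycle; the same shift appears in the inverse and in
`incl`. -/
instance : One (BarExt Γ E) := ⟨⟨1, -barCocycle Γ 1 1⟩⟩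

instance : Inv (BarExt Γ E) :=
  ⟨fun x => ⟨x.base⁻¹, -x.fib - barCocycle Γ x.base⁻¹ x.base - barCocycle Γ 1 1⟩⟩

@[simp] lemma mul_base (x y : BarExt Γ E) : (x * y).base = x.base * y.base := rfl
@[simp] lemma mul_fib (x y : BarExt Γ E) :
    (x * y).fib = x.fib + y.fib + barCocycle Γ x.base y.base := rfl
@[simp] lemma one_base : (1 : BarExt Γ E).base = 1 := rfl
@[simp] lemma one_fib : (1 : BarExt Γ E).fib = -barCocycle Γ 1 1 := rfl
@[simp] lemma inv_base (x : BarExt Γ E) : x⁻¹.base = x.base⁻¹ := rfl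
lemma inv_fib (x : BarExt Γ E) :
    x⁻¹.fib = -x.fib - barCocycle Γ x.base⁻¹ x.base - barCocycle Γ 1 1 := rfl

instance : Group (BarExt Γ E) :=
  Group.ofLeftAxioms
    (fun x y z => by
      refine BarExt.ext (mul_assoc _ _ _) ?_
      have h := barCocycle_add (Γ := Γ) x.base y.base z.base
      simp only [mul_fib, mul_base]
      rw [← sub_eq_zero] at h ⊢
      rw [← neg_eq_zero, ← h]
      abel)
    (fun x => by
      refine BarExt.ext (one_mul _) ?_
      simp [barCocycle_one_left])
    (fun x => by
      refine BarExt.ext (inv_mul_cancel _) ?_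
      simp only [mul_fib, inv_fib, inv_base, one_fib]
      abel)

/-- The projection of the extension to `E`. -/
def proj : BarExt Γ E →* E := ⟨⟨base, rfl⟩, fun _ _ => rfl⟩

/-- The action of `σ` on the extension. -/
def act (σ : Γ) : BarExt Γ E →* BarExt Γ E :=
  MonoidHom.mk' (fun x => ⟨σ • x.base, x.fib⟩) fun x y => by
    refine BarExt.ext (smul_mul' _ _ _) ?_
    simp [barCocycle_smul]

@[simp] lemma act_base (σ : Γ) (x : BarExt Γ E) : (act σ x).base = σ • x.base := rfl
@[simp] lemma act_fib (σ : Γ) (x : BarExt Γ E) : (act σ x).fib = x.fib := rfl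

/-- The inclusion of the kernel. -/
def incl : Multiplicative (BarCoker Γ E) →* BarExt Γ E :=
  MonoidHom.mk' (fun k => ⟨1, k.toAdd - barCocycle Γ 1 1⟩) fun x y => by
    refine BarExt.ext (mul_one 1).symm ?_
    simp
    abel

@[simp] lemma incl_base (k : Multiplicative (BarCoker Γ E)) : (incl k).base = 1 := rfl
@[simp] lemma incl_fib (k : Multiplicative (BarCoker Γ E)) :
    (incl k).fib = k.toAdd - barCocycle Γ 1 1 := rfl

lemma incl_injective : Function.Injective (incl (Γ := Γ) (E := E)) := fun x y h => by
  have := congrArg fib h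
  simpa using this

lemma incl_mul (k : Multiplicative (BarCoker Γ E)) (x : BarExt Γ E) :
    incl k * x = ⟨x.base, k.toAdd + x.fib⟩ := by
  refine BarExt.ext (one_mul _) ?_
  simp [barCocycle_one_left]
  abel

lemma eq_incl {x : BarExt Γ E} (hx : x.base = 1) :
    x = incl (Multiplicative.ofAdd (x.fib + barCocycle Γ 1 1)) := by
  refine BarExt.ext hx ?_
  simp

lemma barCocycle_one_right (a : E) : barCocycle Γ a 1 = barCocycle Γ (1 : E) 1 := by
  have h := barCocycle_add (Γ := Γ) a 1 1
  simp only [mul_one] at h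
  exact (add_right_cancel h).symm

lemma mul_incl (k : Multiplicative (BarCoker Γ E)) (x : BarExt Γ E) :
    x * incl k = incl k * x := by
  rw [incl_mul]
  refine BarExt.ext (mul_one _) ?_
  simp [barCocycle_one_right]
  abel

/-- The differential of the bar complex, on chains of degree `2` modulo boundaries. -/
def fibD : BarCoker Γ E →ₗ[ℤ] (barResolution Γ E).Chains 1 :=
  Submodule.liftQ _ ((barResolution Γ E).dC 1) (by
    rintro _ ⟨y, rfl⟩
    exact dC_dC 1 y)

lemma fibD_mk (z : (barResolution Γ E).Chains 2) :
    fibD (Submodule.Quotient.mk z) = (barResolution Γ E).dC 1 z := rfl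

/-- The homomorphism `(a, k) ↦ [a] + ∂k` to the chains of degree `1`. -/
def toChains : BarExt Γ E →* Multiplicative ((barResolution Γ E).Chains 1) :=
  MonoidHom.mk' (fun x => Multiplicative.ofAdd (symb Γ ![x.base] + fibD x.fib)) fun x y => by
    rw [← ofAdd_add]
    refine congrArg Multiplicative.ofAdd ?_
    rw [mul_base, mul_fib, map_add, map_add, barCocycle, fibD_mk, dC_one_symb]
    abel

lemma toChains_apply (x : BarExt Γ E) :
    toChains x = Multiplicative.ofAdd (symb Γ ![x.base] + fibD x.fib) := rfl

/-- On the kernel of the extension `toChains` is the differential, so it detects which kernel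
elements come from cycles. -/
lemma toChains_incl (z : (barResolution Γ E).Chains 2) :
    toChains (incl (Multiplicative.ofAdd (Submodule.Quotient.mk z))) =
      Multiplicative.ofAdd ((barResolution Γ E).dC 1 z) := by
  rw [toChains_apply]
  refine congrArg Multiplicative.ofAdd ?_
  rw [incl_fib, map_sub, incl_base, toAdd_ofAdd, fibD_mk, barCocycle, fibD_mk, dC_one_symb, mul_one]
  abel

end BarExt

end BarExt

/-! ### The Hopf formula -/

section HopfFormula

variable {Γ P E : Type*} [Group Γ] [Group P] [MulDistribMulAction Γ P]
  [Group E] [MulDistribMulAction Γ E] {τ : P →*[Γ] E}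

/-- A morphism from a projective `Γ`-group to `E` lifts to the extension. -/
lemma exists_lift_barExt (hP : IsGammaProjective Γ P) (τ : P →*[Γ] E) :
    ∃ θ : P →* BarExt Γ E, (∀ p, (θ p).base = τ p) ∧
      ∀ (σ : Γ) p, θ (σ • p) = BarExt.act σ (θ p) := by
  obtain ⟨i, hi, hi'⟩ := hP
  -- Fibre zero makes the lift of the generators equivariant, since $\Gamma$ acts only on the base
  -- component.
  let t : FreeGroup P →* BarExt Γ E := FreeGroup.lift fun p => ⟨τ p, 0⟩
  have h1 : BarExt.proj.comp t = τ.toMonoidHom.comp (FreeGroup.lift fun p => p) :=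
    FreeGroup.ext_hom _ _ fun p => by simp [t, BarExt.proj]
  have h2 : ∀ σ : Γ, t.comp (FreeGroup.map (σ • ·)) = (BarExt.act σ).comp t := fun σ =>
    FreeGroup.ext_hom _ _ fun p => by
      simp only [t, MonoidHom.comp_apply, FreeGroup.map.of, FreeGroup.lift_apply_of]
      exact BarExt.ext (map_smul τ σ p) rfl
  refine ⟨t.comp i, fun p => ?_, fun σ p => ?_⟩
  · exact (DFunLike.congr_fun h1 (i p)).trans (congrArg τ (hi' p))
  · rw [MonoidHom.comp_apply, hi]
    exact DFunLike.congr_fun (h2 σ) (i p)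

/-- The lift sends $R$ into the kernel of the extension, which is central with trivial
$\Gamma$-action. -/
lemma gammaComm_le_ker_of_lift {θ : P →* BarExt Γ E} (hθ : ∀ p, (θ p).base = τ p)
    (hθ' : ∀ (σ : Γ) p, θ (σ • p) = BarExt.act σ (θ p)) : gammaComm Γ (gker τ) ≤ θ.ker := by
  refine (Subgroup.closure_le _).2 ?_
  rintro _ ⟨x, y, hy, σ, rfl⟩
  have hb : (θ y).base = 1 := (hθ y).trans hy
  have h1 : θ (σ • y) = θ y := by
    rw [hθ']
    exact BarExt.ext (by rw [BarExt.act_base, hb, smul_one]) rfl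
  rw [SetLike.mem_coe, MonoidHom.mem_ker, map_mul, map_mul, map_mul, map_inv, map_inv, h1,
    BarExt.eq_incl hb, BarExt.mul_incl]
  simp

namespace GammaSection

variable (s : GammaSection τ)

/-- The function `a ↦ fib(θ(s(a)))`, extended to the chains of degree `1`. -/
def liftDefect (θ : P →* BarExt Γ E) (hθ' : ∀ (σ : Γ) p, θ (σ • p) = BarExt.act σ (θ p)) :
    (barResolution Γ E).Chains 1 →ₗ[ℤ] BarCoker Γ E :=
  chainsLift (fun v => (θ (s.toFun (v 0))).fib) fun σ v => by
    rw [s.map_smul', hθ', BarExt.act_fib]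

/-- The extension has two sections over $E$: $\theta\circ s$, and $a\mapsto(a,0)$ with factor set
$[a,b]$. They differ by the central elements recorded in `liftDefect`, hence the coboundary term. -/
lemma lift_hopfChains {θ : P →* BarExt Γ E} (hθ : ∀ p, (θ p).base = τ p)
    (hθ' : ∀ (σ : Γ) p, θ (σ • p) = BarExt.act σ (θ p)) (z : (barResolution Γ E).Chains 2) :
    QuotientGroup.lift _ θ (gammaComm_le_ker_of_lift hθ hθ') (s.hopfChains z).toMul =
      BarExt.incl (Multiplicative.ofAdd (Submodule.Quotient.mk z +
        s.liftDefect θ hθ' ((barResolution Γ E).dC 1 z))) := by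
  induction z using chains_induction with
  | zero => simp
  | add x y hx hy =>
    rw [map_add s.hopfChains, toMul_add, Subgroup.coe_mul, map_mul, hx, hy, ← map_mul, ← ofAdd_add,
      map_add ((barResolution Γ E).dC 1), map_add (s.liftDefect θ hθ'),
      Submodule.Quotient.mk_add, add_add_add_comm]
  | neg x hx =>
    rw [map_neg s.hopfChains, toMul_neg, Subgroup.coe_inv, map_inv, hx, ← map_inv, ← ofAdd_neg,
      map_neg ((barResolution Γ E).dC 1), map_neg (s.liftDefect θ hθ'),
      Submodule.Quotient.mk_neg, neg_add]
  | symb v =>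
    obtain ⟨a, b, rfl⟩ : ∃ a b, v = ![a, b] := ⟨v 0, v 1, by ext i; fin_cases i <;> rfl⟩
    rw [hopfChains_symb]
    change θ (s.toFun a * s.toFun b * (s.toFun (a * b))⁻¹) = _
    rw [map_mul, map_inv, mul_inv_eq_iff_eq_mul, BarExt.incl_mul, map_mul]
    refine BarExt.ext ?_ ?_
    · simp [hθ, s.right_inv']
    · rw [dC_one_symb, map_add (s.liftDefect θ hθ'), map_sub (s.liftDefect θ hθ')]
      simp only [liftDefect, chainsLift_symb, BarExt.mul_fib, hθ, s.right_inv', toAdd_ofAdd,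
        Matrix.cons_val_zero, barCocycle]
      abel

/-- On cycles the coboundary term drops out, so the map induced by $\theta$ returns the class of the
cycle modulo boundaries. -/
lemma hopf_injective (hP : IsGammaProjective Γ P) : Function.Injective s.hopf := by
  obtain ⟨θ, hθ, hθ'⟩ := exists_lift_barExt hP τ
  refine (injective_iff_map_eq_zero _).2 fun x hx => ?_
  obtain ⟨⟨z, hz⟩, rfl⟩ := Submodule.Quotient.mk_surjective _ x
  have h := s.lift_hopfChains hθ hθ' z
  rw [show ((s.hopfChains z).toMul : Cover τ) = 1 from congrArg Additive.toMul hx, map_one,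
    show (barResolution Γ E).dC 1 z = 0 from hz, map_zero, add_zero] at h
  have h0 := BarExt.incl_injective ((map_one BarExt.incl).trans h)
  have h1 : (Submodule.Quotient.mk z : BarCoker Γ E) = 0 :=
    (congrArg Multiplicative.toAdd h0).symm
  exact (Submodule.Quotient.mk_eq_zero _).2
    ((Submodule.Quotient.mk_eq_zero ((barResolution Γ E).boundaries 2)).1 h1)

/-- The map of `hopfChains` on chains modulo boundaries. -/
def hopfCoker : BarCoker Γ E →ₗ[ℤ] Additive (Subgroup.center (Cover τ)) :=
  Submodule.liftQ _ s.hopfChains (by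
    rintro _ ⟨y, rfl⟩
    exact s.hopfChains_dC y)

/-- The homomorphism `(a, k) ↦ s(a) φ(k)` from the extension to `P / [P, R]_Γ`. -/
def extToCover : BarExt Γ E →* Cover τ :=
  MonoidHom.mk' (fun x => (s.hopfCoker x.fib).toMul * (s.toFun x.base : Cover τ)) fun x y => by
    have hx := Subgroup.mem_center_iff.1 (s.hopfCoker y.fib).toMul.2 (s.toFun x.base)
    have h : ((s.hopfCoker (barCocycle Γ x.base y.base)).toMul : Cover τ) *
        s.toFun (x.base * y.base) = s.toFun x.base * s.toFun y.base := by
      refine (congrArg (· * _) (s.coe_hopfChains_symb x.base y.base)).trans ?_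
      simp
    rw [BarExt.mul_base, BarExt.mul_fib, map_add s.hopfCoker, map_add s.hopfCoker,
      toMul_add, toMul_add, Subgroup.coe_mul,
      Subgroup.coe_mul, mul_assoc, h, mul_assoc, ← mul_assoc _ _ (s.toFun y.base : Cover τ), ← hx]
    simp only [mul_assoc]

lemma extToCover_incl (z : (barResolution Γ E).Chains 2) :
    s.extToCover (BarExt.incl (Multiplicative.ofAdd (Submodule.Quotient.mk z))) =
      (s.hopfChains z).toMul := by
  change ((s.hopfCoker (Submodule.Quotient.mk z - barCocycle Γ 1 1)).toMul : Cover τ) *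
    (s.toFun 1 : Cover τ) = _
  -- The factor $s(1)s(1)s(1)^{-1}$ is $s(1)$, so the shift in `incl` cancels the value of the
  -- section at the identity.
  have h1 : ((s.hopfCoker (barCocycle Γ 1 1)).toMul : Cover τ) = s.toFun 1 :=
    (s.coe_hopfChains_symb 1 1).trans (by simp)
  rw [map_sub, toMul_sub, div_eq_mul_inv, Subgroup.coe_mul, Subgroup.coe_inv, h1]
  simp
  rfl

/-- Both `s.extToCover ∘ θ` and the projection of $P$ lie over $\tau$. They differ by a
$\Gamma$-invariant homomorphism to the center, which kills $[P,P]_\Gamma$. -/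
lemma extToCover_lift {θ : P →* BarExt Γ E} (hθ : ∀ p, (θ p).base = τ p)
    (hθ' : ∀ (σ : Γ) p, θ (σ • p) = BarExt.act σ (θ p)) {p : P}
    (hp : p ∈ gammaComm Γ (⊤ : Subgroup P)) : s.extToCover (θ p) = p := by
  have hmem : ∀ p, s.toFun (τ p) * p⁻¹ ∈ gker τ := fun p => by
    change τ _ = 1
    rw [map_mul, map_inv, s.right_inv', mul_inv_cancel]
  obtain ⟨c, hc, hc'⟩ : ∃ c : P → Subgroup.center (Cover τ),
      (∀ p, s.extToCover (θ p) * (p : Cover τ)⁻¹ = c p) ∧ ∀ (σ : Γ) p, c (σ • p) = c p := by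
    -- Inserting $s(\tau p)$ splits the difference into two factors, each visibly central and
    -- $\Gamma$-invariant.
    refine ⟨fun p => (s.hopfCoker (θ p).fib).toMul * kerToCenter τ ⟨_, hmem p⟩,
      fun p => ?_, fun σ p => ?_⟩
    · change _ * (s.toFun (θ p).base : Cover τ) * _ =
        _ * ((s.toFun (τ p) : Cover τ) * (p : Cover τ)⁻¹)
      rw [hθ, mul_assoc]
    · beta_reduce
      rw [hθ', BarExt.act_fib]
      refine congrArg _ (kerToCenter_smul τ σ _ _ ?_)
      simp [← s.map_smul', map_smul]
  let D : P →* Subgroup.center (Cover τ) := MonoidHom.mk' c fun p q => Subtype.ext <| by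
    have h := Subgroup.mem_center_iff.1 (c q).2 (p : Cover τ)⁻¹
    rw [Subgroup.coe_mul, ← hc p, mul_assoc, h, ← hc, ← hc, map_mul, map_mul, QuotientGroup.mk_mul,
      mul_inv_rev]
    simp only [mul_assoc]
  have h1 : (c p : Cover τ) = 1 := congrArg Subtype.val (gammaComm_le_ker D hc' _ hp)
  exact mul_inv_eq_one.1 ((hc p).trans h1)

lemma exists_hopf_of_mem (hP : IsGammaProjective Γ P) {r : P} (hr : r ∈ gker τ)
    (hr' : r ∈ gammaComm Γ (⊤ : Subgroup P)) :
    ∃ x : H Γ E 2, (s.hopf x).toMul = (r : Cover τ) := by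
  obtain ⟨θ, hθ, hθ'⟩ := exists_lift_barExt hP τ
  have h1 := BarExt.eq_incl ((hθ r).trans hr)
  obtain ⟨z, hz⟩ := Submodule.Quotient.mk_surjective _ ((θ r).fib + barCocycle Γ 1 1)
  rw [← hz] at h1
  -- The composite is $\Gamma$-invariant with commutative target, so it vanishes on $[P,P]_\Gamma$;
  -- at $r$ its value is $\partial z$, so $z$ is a cycle.
  have h2 : (BarExt.toChains.comp θ) r = 1 := by
    refine gammaComm_le_ker (Γ := Γ) _ (fun σ p => ?_) _ hr'
    rw [MonoidHom.comp_apply, MonoidHom.comp_apply, hθ', BarExt.toChains_apply, BarExt.act_base,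
      BarExt.act_fib, BarExt.toChains_apply, ← symb_smul σ ![(θ p).base]]
    congr 4
    ext i
    fin_cases i
    rfl
  rw [MonoidHom.comp_apply, h1, BarExt.toChains_incl] at h2
  refine ⟨Submodule.Quotient.mk ⟨z, congrArg Multiplicative.toAdd h2⟩, ?_⟩
  have h3 := s.extToCover_lift hθ hθ' hr'
  rw [h1, extToCover_incl] at h3
  exact h3

end GammaSection

end HopfFormula

/-! ### The exact sequence -/

section ExactSequence

/-- Both $\iota$ and $\delta$ are obtained by factoring a map through an embedding, which makes
additivity automatic. -/
lemma exists_addMonoidHom_comp_eq {A B C : Type*} [AddGroup A] [AddGroup B] [AddGroup C]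
    (f : A →+ C) (g : B →+ C) (hg : Function.Injective g) (h : ∀ a, ∃ b, g b = f a) :
    ∃ k : A →+ B, ∀ a, g (k a) = f a := by
  choose k hk using h
  exact ⟨AddMonoidHom.mk' k fun a b => hg (by rw [map_add, hk, hk, hk, map_add]), hk⟩

variable {Γ P E G N : Type*} [Group Γ] [Group P] [MulDistribMulAction Γ P]
  [Group E] [MulDistribMulAction Γ E] [Group G] [MulDistribMulAction Γ G]
  [Group N] [MulDistribMulAction Γ N]

/-- The homomorphism `[P, S]_Γ / [P, R]_Γ → P / [P, R]_Γ`. -/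
def commQuotToCover (τ : P →*[Γ] E) (α : E →*[Γ] G) :
    (gammaComm Γ (gker (α.comp τ)) ⧸
      (gammaComm Γ (gker τ)).subgroupOf (gammaComm Γ (gker (α.comp τ)))) →* Cover τ :=
  QuotientGroup.map _ _ (gammaComm Γ (gker (α.comp τ))).subtype le_rfl

lemma commQuotToCover_injective (τ : P →*[Γ] E) (α : E →*[Γ] G) :
    Function.Injective (commQuotToCover τ α) := by
  refine (injective_iff_map_eq_one _).2 ?_
  rintro ⟨x⟩ hx
  exact (QuotientGroup.eq_one_iff _).2 ((QuotientGroup.eq_one_iff (x : P)).1 hx)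

/-- The homomorphism `U → P / [P, R]_Γ`. -/
def uToCover (τ : P →*[Γ] E) (α : E →*[Γ] G) : U τ α →* Cover τ :=
  (commQuotToCover τ α).comp (U τ α).subtype

lemma uToCover_injective (τ : P →*[Γ] E) (α : E →*[Γ] G) :
    Function.Injective (uToCover τ α) :=
  (commQuotToCover_injective τ α).comp Subtype.val_injective

/-- This identifies $U$ with $(R\cap[P,S]_\Gamma)/[P,R]_\Gamma$ inside $P/[P,R]_\Gamma$. -/
lemma exists_uToCover_eq_iff (τ : P →*[Γ] E) (α : E →*[Γ] G) (y : Cover τ) :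
    (∃ x, uToCover τ α x = y) ↔
      ∃ p ∈ gammaComm Γ (gker (α.comp τ)), p ∈ gker τ ∧ (p : Cover τ) = y := by
  constructor
  · rintro ⟨⟨⟨x⟩, hx⟩, rfl⟩
    exact ⟨x, x.2, congrArg Subtype.val (MonoidHom.mem_ker.1 hx), rfl⟩
  · rintro ⟨p, hp, hp', rfl⟩
    exact ⟨⟨QuotientGroup.mk ⟨p, hp⟩, MonoidHom.mem_ker.2 (Subtype.ext hp')⟩, rfl⟩

/-- The homomorphism `N / [E, N]_Γ → E / [E, N]_Γ`. -/
def kerQuotToQuot (i : N →*[Γ] E) : N ⧸ commIn i →* E ⧸ gammaComm Γ i.toMonoidHom.range :=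
  QuotientGroup.map _ _ i.toMonoidHom le_rfl

lemma kerQuotToQuot_injective (i : N →*[Γ] E) : Function.Injective (kerQuotToQuot i) := by
  refine (injective_iff_map_eq_one _).2 ?_
  rintro ⟨x⟩ hx
  exact (QuotientGroup.eq_one_iff _).2 ((QuotientGroup.eq_one_iff (i x)).1 hx)

/-- The homomorphism `N / [E, N]_Γ → H_1^Γ(E)`. -/
def kerQuotToHOne (i : N →*[Γ] E) : Additive (N ⧸ commIn i) →+ H Γ E 1 :=
  MonoidHom.toAdditiveLeft <|
    QuotientGroup.lift (commIn i) ((clsHom Γ E).comp i.toMonoidHom) fun n hn => by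
      have h : i n ∈ (clsHom Γ E).ker := by
        rw [ker_clsHom]
        exact gammaComm_mono le_top hn
      exact h

lemma kerQuotToHOne_mk (i : N →*[Γ] E) (n : N) :
    kerQuotToHOne i (Additive.ofMul (n : N ⧸ commIn i)) = H.cls Γ (i n) := rfl

lemma cls_eq_zero_iff (e : E) : H.cls Γ e = 0 ↔ e ∈ gammaComm Γ (⊤ : Subgroup E) := by
  rw [← ker_clsHom]
  exact Iff.rfl

lemma exists_cls_eq (x : H Γ E 1) : ∃ e, H.cls Γ e = x := clsHom_surjective x

lemma exists_map_eq_of_mem_gammaComm_top (f : E →*[Γ] G) (hf : Function.Surjective f) {g : G}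
    (hg : g ∈ gammaComm Γ (⊤ : Subgroup G)) : ∃ e ∈ gammaComm Γ (⊤ : Subgroup E), f e = g := by
  have h := map_gammaComm f hf ⊤
  rw [Subgroup.map_top_of_surjective _ hf] at h
  rw [← h] at hg
  exact hg

lemma H.map_one_surjective (α : E →*[Γ] G) (hα : Function.Surjective α) :
    Function.Surjective (H.map α 1) := fun x => by
  obtain ⟨g, rfl⟩ := exists_cls_eq x
  obtain ⟨e, rfl⟩ := hα g
  exact ⟨H.cls Γ e, H.map_cls α e⟩

lemma exact_kerQuotToHOne (i : N →*[Γ] E) (α : E →*[Γ] G) (hα : Function.Surjective α)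
    (hexact : i.toMonoidHom.range = α.toMonoidHom.ker) :
    Function.Exact (kerQuotToHOne i) (H.map α 1) := by
  intro x
  constructor
  · intro hx
    obtain ⟨e, rfl⟩ := exists_cls_eq x
    rw [H.map_cls, cls_eq_zero_iff] at hx
    -- Dividing $e$ by a lift of $\alpha(e)$ in $[E,E]_\Gamma$ keeps its homology class and moves it
    -- into $N$.
    obtain ⟨c, hc, hce⟩ := exists_map_eq_of_mem_gammaComm_top α hα hx
    obtain ⟨n, hn⟩ : e * c⁻¹ ∈ i.toMonoidHom.range := by
      rw [hexact]
      change α _ = 1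
      rw [map_mul, map_inv, hce, mul_inv_cancel]
    refine ⟨Additive.ofMul (n : N ⧸ commIn i), ?_⟩
    rw [kerQuotToHOne_mk, show i n = e * c⁻¹ from hn]
    refine (congrArg Multiplicative.toAdd (map_mul (clsHom Γ E) e c⁻¹)).trans ?_
    have h1 : clsHom Γ E c⁻¹ = 1 := by
      rw [← MonoidHom.mem_ker, ker_clsHom]
      exact inv_mem hc
    rw [h1, mul_one]
    rfl
  · rintro ⟨⟨n⟩, rfl⟩
    have h1 : α (i n) = 1 := by
      have : i n ∈ α.toMonoidHom.ker := hexact ▸ ⟨n, rfl⟩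
      exact this
    refine (H.map_cls α (i n)).trans ?_
    rw [h1, cls_eq_zero_iff]
    exact one_mem _

/-- The exact sequence of a short exact sequence of `Γ`-groups and a projective presentation. -/
theorem exists_exact_sequence
    (i : N →*[Γ] E) (α : E →*[Γ] G)
    (hexact : i.toMonoidHom.range = α.toMonoidHom.ker)
    (hα : Function.Surjective α) (hsec : HasGammaSection α)
    (τ : P →*[Γ] E) (hτ : IsProjectivePresentation τ) :
    ∃ (ι : Additive (U τ α) →+ H Γ E 2)
      (δ : H Γ G 2 →+ Additive (N ⧸ commIn i))
      (j : Additive (N ⧸ commIn i) →+ H Γ E 1),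
      (∀ n : N, j (Additive.ofMul (n : N ⧸ commIn i))
        = H.cls Γ (i n)) ∧
      Function.Injective ι ∧
      Function.Exact ι (H.map α 2) ∧
      Function.Exact (H.map α 2) δ ∧
      Function.Exact δ j ∧
      Function.Exact j (H.map α 1) ∧
      Function.Surjective (H.map α 1) := by
  obtain ⟨hP, s', hs, hs'⟩ := hτ
  obtain ⟨a', ha, ha'⟩ := hsec
  let s : GammaSection τ := ⟨s', hs, hs'⟩
  let t : GammaSection (α.comp τ) :=
    ⟨fun g => s' (a' g), fun σ g => by rw [ha, hs], fun g => by
      change α (τ _) = g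
      rw [hs', ha']⟩
  have hτs : Function.Surjective τ := fun e => ⟨s' e, hs' e⟩
  have hS : (gker (α.comp τ)).map τ.toMonoidHom = i.toMonoidHom.range := by
    rw [hexact]
    exact Subgroup.map_comap_eq_self_of_surjective (f := τ.toMonoidHom) hτs α.toMonoidHom.ker
  have hR : gker τ ≤ gker (α.comp τ) := fun x (hx : τ x = 1) => by
    change α (τ x) = 1
    rw [hx, map_one]
  -- the map `P / [P, S]_Γ → E / [E, N]_Γ`
  let w : Cover (α.comp τ) →* E ⧸ gammaComm Γ i.toMonoidHom.range :=
    QuotientGroup.map _ _ τ.toMonoidHom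
      (gammaComm_le_comap τ fun y hy => hS ▸ Subgroup.mem_map_of_mem _ hy)
  obtain ⟨ι, hι⟩ := exists_addMonoidHom_comp_eq (MonoidHom.toAdditive (uToCover τ α)) s.hopf
    (s.hopf_injective hP) fun u => by
      obtain ⟨p, hp, hp', h⟩ := (exists_uToCover_eq_iff τ α _).1 ⟨u.toMul, rfl⟩
      obtain ⟨x, hx⟩ := s.exists_hopf_of_mem hP hp' (gammaComm_mono le_top hp)
      exact ⟨x, hx.trans h⟩
  -- If $q\in S\cap[P,P]_\Gamma$ represents a class of $H_2^\Gamma(G)$, its image under $\delta$ is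
  -- the class of $\tau(q)$, which lies in $N$.
  obtain ⟨δ, hδ⟩ := exists_addMonoidHom_comp_eq ((MonoidHom.toAdditive w).comp t.hopf)
    (MonoidHom.toAdditive (kerQuotToQuot i)) (kerQuotToQuot_injective i) fun x => by
      obtain ⟨q, ⟨hq, -⟩, h⟩ := t.exists_hopf_eq x
      obtain ⟨n, hn⟩ : τ q ∈ i.toMonoidHom.range := hS ▸ Subgroup.mem_map_of_mem _ hq
      refine ⟨Additive.ofMul (n : N ⧸ commIn i), ?_⟩
      change ((i n : E) : E ⧸ gammaComm Γ i.toMonoidHom.range) = w (t.hopf x).toMul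
      rw [h, show i n = τ q from hn]
      rfl
  have hδ' : ∀ x, kerQuotToQuot i (δ x).toMul = w (t.hopf x).toMul := hδ
  refine ⟨ι, δ, kerQuotToHOne i, fun n => rfl, fun u u' h => uToCover_injective τ α ?_,
    fun x => ?_, fun y => ?_, ?_, exact_kerQuotToHOne i α hα hexact, H.map_one_surjective α hα⟩
  · exact (hι u).symm.trans ((congrArg s.hopf h).trans (hι u'))
  · obtain ⟨r, ⟨hr, -⟩, h⟩ := s.exists_hopf_eq x
    -- By naturality the same $r$ represents the image of $x$, now modulo $[P,S]_\Gamma$.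
    have h1 : H.map α 2 x = 0 ↔ r ∈ gammaComm Γ (gker (α.comp τ)) := by
      have hn := s.coverMap_hopf α t x
      rw [h] at hn
      rw [← map_eq_zero_iff _ (t.hopf_injective hP), ← QuotientGroup.eq_one_iff]
      exact ⟨fun h0 => hn.trans h0, fun h0 => hn.symm.trans h0⟩
    rw [h1]
    constructor
    · intro hr'
      obtain ⟨u, hu⟩ := (exists_uToCover_eq_iff τ α r).2 ⟨r, hr', hr, rfl⟩
      exact ⟨Additive.ofMul u, s.hopf_injective hP ((hι _).trans (hu.trans h.symm))⟩
    · rintro ⟨u, rfl⟩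
      obtain ⟨p, hp, -, hpr⟩ := (exists_uToCover_eq_iff τ α r).1
        ⟨u.toMul, (hι u).symm.trans h⟩
      have hm := gammaComm_mono (Γ := Γ) hR (QuotientGroup.eq.1 hpr)
      simpa using mul_mem hp hm
  · obtain ⟨q, ⟨hq, hq'⟩, h⟩ := t.exists_hopf_eq y
    constructor
    · intro hy
      have h1 := hδ' y
      rw [hy, h] at h1
      have h2 : τ q ∈ gammaComm Γ i.toMonoidHom.range :=
        (QuotientGroup.eq_one_iff (τ q)).1 (h1.symm.trans (map_one _))
      rw [← hS, ← map_gammaComm τ hτs] at h2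
      obtain ⟨c, hc, hcq⟩ := h2
      -- Since $\tau(q)\in[E,N]_\Gamma=\tau([P,S]_\Gamma)$, correcting $q$ by $c\in[P,S]_\Gamma$
      -- puts it in $R\cap[P,P]_\Gamma$ without changing its class modulo $[P,S]_\Gamma$.
      obtain ⟨x, hx⟩ := s.exists_hopf_of_mem hP (r := q * c⁻¹)
        (by
          change τ _ = 1
          rw [map_mul, map_inv, show τ c = τ q from hcq, mul_inv_cancel])
        (mul_mem hq' (inv_mem (gammaComm_mono le_top hc)))
      refine ⟨x, t.hopf_injective hP ?_⟩
      refine (s.coverMap_hopf α t x).symm.trans (Eq.trans ?_ h.symm)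
      rw [hx]
      refine QuotientGroup.eq.2 ?_
      change (q * c⁻¹)⁻¹ * q ∈ _
      simpa using hc
    · rintro ⟨x, rfl⟩
      obtain ⟨r, ⟨hr, -⟩, hx⟩ := s.exists_hopf_eq x
      have h1 := hδ' (H.map α 2 x)
      rw [← s.coverMap_hopf α t x, hx] at h1
      refine kerQuotToQuot_injective i (h1.trans ?_)
      change ((τ r : E) : E ⧸ gammaComm Γ i.toMonoidHom.range) = _
      rw [show τ r = 1 from hr]
      exact (map_one (kerQuotToQuot i)).symm
  · rintro ⟨n⟩
    refine (show kerQuotToHOne i (Additive.ofMul (n : N ⧸ commIn i)) = 0 ↔ _ from ?_)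
    rw [kerQuotToHOne_mk, cls_eq_zero_iff]
    constructor
    · intro hn
      -- A lift of $n$ in $[P,P]_\Gamma$ lies automatically in $S$, so it represents a class of
      -- $H_2^\Gamma(G)$.
      obtain ⟨p, hp, hpn⟩ := exists_map_eq_of_mem_gammaComm_top τ hτs hn
      have hpS : p ∈ gker (α.comp τ) := by
        have h1 : i n ∈ α.toMonoidHom.ker := hexact ▸ ⟨n, rfl⟩
        change α (τ p) = 1
        rw [hpn]
        exact h1
      obtain ⟨x, hx⟩ := t.exists_hopf_of_mem hP hpS hp
      refine ⟨x, kerQuotToQuot_injective i ((hδ' x).trans ?_)⟩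
      rw [hx]
      exact congrArg QuotientGroup.mk hpn
    · rintro ⟨x, hx⟩
      obtain ⟨q, ⟨-, hq'⟩, h⟩ := t.exists_hopf_eq x
      have h1 := hδ' x
      rw [hx, h] at h1
      have h2 : (τ q)⁻¹ * i n ∈ gammaComm Γ i.toMonoidHom.range := QuotientGroup.eq.1 h1.symm
      have h3 : τ q ∈ gammaComm Γ (⊤ : Subgroup E) :=
        gammaComm_le_comap τ (fun _ _ => Subgroup.mem_top _) hq'
      simpa using mul_mem h3 (gammaComm_mono le_top h2)

end ExactSequence

end EquivHomology

end

/-- For a short exact sequence `1 → N → E → G → 1` of `Γ`-groups, with maps `i` and `α`, such that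
`α` has a `Γ`-equivariant section, and a projective presentation `τ : P → E`, there is an exact
sequence `0 → U → H₂(E) → H₂(G) → N/[E,N]_Γ → H₁(E) → H₁(G) → 0`. -/
theorem theorem19 {Γ N E G P : Type*} [Group Γ]
    [Group N] [MulDistribMulAction Γ N] [Group E] [MulDistribMulAction Γ E]
    [Group G] [MulDistribMulAction Γ G] [Group P] [MulDistribMulAction Γ P]
    (i : N →*[Γ] E) (α : E →*[Γ] G)
    (hi : Function.Injective i) (hexact : i.toMonoidHom.range = α.toMonoidHom.ker)
    (hα : Function.Surjective α) (hsec : EquivHomology.HasGammaSection α)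
    (τ : P →*[Γ] E) (hτ : EquivHomology.IsProjectivePresentation τ) :
    ∃ (ι : Additive (EquivHomology.U τ α) →+ EquivHomology.H Γ E 2)
      (δ : EquivHomology.H Γ G 2 →+ Additive (N ⧸ EquivHomology.commIn i))
      (j : Additive (N ⧸ EquivHomology.commIn i) →+ EquivHomology.H Γ E 1),
      (∀ n : N, j (Additive.ofMul (n : N ⧸ EquivHomology.commIn i))
        = EquivHomology.H.cls Γ (i n)) ∧
      Function.Injective ι ∧
      Function.Exact ι (EquivHomology.H.map α 2) ∧
      Function.Exact (EquivHomology.H.map α 2) δ ∧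
      Function.Exact δ j ∧
      Function.Exact j (EquivHomology.H.map α 1) ∧
      Function.Surjective (EquivHomology.H.map α 1) :=
  EquivHomology.exists_exact_sequence i α hexact hα hsec τ hτ
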